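/- Let $H$ be a separable complex Hilbert space and let $T$ be a selfadjoint operator in $H$ with an orthonormal basis of eigenvectors $\phi_k\in\operatorname{dom}T$, $T\phi_k=t_k\phi_k$, $k=1,2,\dots$, where $t_k<t_{k+1}$ for all $k\ge1$. Suppose that for some integer $p\ge1$ and some $d>0$ $$t_{k+p}-t_k>d\qquad\text{for all }k\ge1 .$$ For $k\ge1$ let $\gamma(k)\in\{0,\dots,p-1\}$ be the least integer $g\ge 0$ with $t_{k+g+1}-t_{k+g}\ge d/p$. Put $j_1=1$, $j_2=1+\gamma(1)$, $j_{k+1}=(j_k+1)+\gamma(j_k+1)$ for $k\ge2$, and $T_k=t_{j_k}$. Let $$F_1=\Big[T_1-\frac d{2p},\,T_2+\frac d{2p}\Big],\qquad F_k=\Big[T_k+\frac d{2p},\,T_{k+1}+\frac d{2p}\Big]\quad(k\ge2),$$ $$\Pi_k=\Big\{a+ib:\ a\in F_k,\ |b|\le\frac d{2p}\Big\},\qquad \Gamma_k=\partial\Pi_k\quad(k\ge1).$$ Let $B$ be a closed operator in $H$ with $\operatorname{dom}B\supseteq\operatorname{dom}T$, and let $L=T+B$ with $\operatorname{dom} L=\operatorname{dom}T$.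 Put $\beta_k=\|B\phi_k\|^2$ and $\|\beta\|_\infty=\sup_k\beta_k$, and suppose $$\limsup_{k\to\infty}\beta_k<\Big(\frac d{2p}\Big)^2\frac1{8p(1+\pi^2/3)} .$$ Let $M,N\ge0$ be integers with $K:=M+N\ge1$ such that $$\beta_k\le\Big(\frac d{2p}\Big)^2\frac1{8p(1+\pi^2/3)}\ \text{ for all }k\ge M,\qquad \|\beta\|_\infty\le\frac{d^2}{16p^2}\Big(2p\sum_{j=N+1}^\infty\frac1{j^2}\Big)^{-1},$$ let $h>0$ satisfy $$8p\,\|\beta\|_\infty\sum_{j=0}^\infty\frac1{h^2+\big(\frac{jd}{2p}\big)^2}\le1 ,$$ and put $$\Pi_0=\Big\{a+ib:\ \min(T_1,0)-h\le a\le T_{K+1}+\frac d{2p},\ |b|\le h\Big\},\qquad \Gamma_0=\partial\Pi_0 .$$ Write $R^0(z)=(z-T)^{-1}$ and $R(z)=(z-L)^{-1}$ for $z$ outside the respective spectrum. Then $\Gamma_j\cap\operatorname{Sp}T=\emptyset$ for all $j\ge1$, and $\Gamma_0$ and $\Gamma_j$, $j\ge K+1$, do not meet $\operatorname{Sp}L$,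 so that the operators $$P_j^0=\frac1{2\pi i}\int_{\Gamma_j}R^0(z)\,dz\ (j\ge1),\quad S_K=\frac1{2\pi i}\int_{\Gamma_0}R(z)\,dz,\quad P_j=\frac1{2\pi i}\int_{\Gamma_j}R(z)\,dz\ (j\ge K+1)$$ (contours counterclockwise) are well defined. With $\dim$ denoting the dimension of the range, $$\dim S_K=\sum_{j=1}^K\dim P_j^0\le pK,\qquad \dim P_j=\dim P_j^0\le p\quad\text{for all }j\ge K+1,$$ and every $z\notin\Pi_0\cup\bigcup_{j=K+1}^\infty\Pi_j$ lies outside $\operatorname{Sp}L$ and satisfies $$\|R(z)\|\le\max\Big\{\frac{4p}d,\ \frac2h\Big\};$$ in particular $\|R(z)\|\le 4p/d$ for all these $z$ if $h\ge d/(2p)$. -/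

import Mathlib

open Filter

noncomputable section

namespace RootSystem

section Resolvent

variable {H : Type*} [NormedAddCommGroup H] [InnerProductSpace ℂ H]

/-- The bounded operator `R` is a two-sided inverse of `z - A : dom A → H`. -/
def IsResolventAt (A : H →ₗ.[ℂ] H) (z : ℂ) (R : H →L[ℂ] H) : Prop :=
  (∀ f : H, ∃ hf : R f ∈ A.domain, z • R f - A ⟨R f, hf⟩ = f) ∧
    ∀ x : A.domain, R (z • (x : H) - A x) = x

/-- The complement of the spectrum of a (possibly unbounded) operator: the points `z` at which
`z - A : dom A → H` has a bounded everywhere defined two-sided inverse. -/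
def resolventSet (A : H →ₗ.[ℂ] H) : Set ℂ :=
  {z | ∃ R : H →L[ℂ] H, IsResolventAt A z R}

open Classical in
/-- `(z - A)⁻¹` for `z` outside the spectrum of `A` (the value is `0` on the spectrum). -/
def resolventOp (A : H →ₗ.[ℂ] H) (z : ℂ) : H →L[ℂ] H :=
  if h : ∃ R : H →L[ℂ] H, IsResolventAt A z R then h.choose else 0

/-- The closed rectangle `{a + ib : a₁ ≤ a ≤ a₂, b₁ ≤ b ≤ b₂}`. -/
def rect (a₁ a₂ b₁ b₂ : ℝ) : Set ℂ :=
  {z | (a₁ ≤ z.re ∧ z.re ≤ a₂) ∧ (b₁ ≤ z.im ∧ z.im ≤ b₂)}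

/-- The integral of `f` over the boundary of the rectangle `rect a₁ a₂ b₁ b₂`,
counterclockwise. -/
def rectIntegral (f : ℂ → H →L[ℂ] H) (a₁ a₂ b₁ b₂ : ℝ) : H →L[ℂ] H :=
  (∫ x : ℝ in a₁..a₂, f (x + b₁ * Complex.I)) - (∫ x : ℝ in a₁..a₂, f (x + b₂ * Complex.I))
    + Complex.I • (∫ y : ℝ in b₁..b₂, f (a₂ + y * Complex.I))
    - Complex.I • (∫ y : ℝ in b₁..b₂, f (a₁ + y * Complex.I))

/-- `(1 / 2πi) ∫ (z - A)⁻¹ dz` over the boundary of `rect a₁ a₂ b₁ b₂`. -/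
def rieszIntegral (A : H →ₗ.[ℂ] H) (a₁ a₂ b₁ b₂ : ℝ) : H →L[ℂ] H :=
  (1 / (2 * (Real.pi : ℂ) * Complex.I)) • rectIntegral (resolventOp A) a₁ a₂ b₁ b₂

/-- The dimension (as a cardinal) of the range of an operator. -/
def rangeDim (S : H →L[ℂ] H) : Cardinal :=
  Module.rank ℂ (LinearMap.range (S : H →ₗ[ℂ] H))

end Resolvent

/-! The eigenvalues are `t 1 < t 2 < ...`; the value `t 0` is never used. The boxes have half
height `d / (2p)`. -/

/-- `γ(k)`: the least `g` for which the gap `t (k+g+1) - t (k+g)` is at least `d / p`. -/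
def gapOffset (t : ℕ → ℝ) (p : ℕ) (d : ℝ) (k : ℕ) : ℕ :=
  sInf {g : ℕ | d / p ≤ t (k + g + 1) - t (k + g)}

/-- The indices `j_k`, `k ≥ 1` (the value at `0` is never used): `j_1 = 1`, `j_2 = 1 + γ(1)` and
`j_{k+1} = (j_k + 1) + γ(j_k + 1)` for `k ≥ 2`. -/
def nodeIndex (t : ℕ → ℝ) (p : ℕ) (d : ℝ) : ℕ → ℕ
  | 0 => 0
  | 1 => 1
  | 2 => 1 + gapOffset t p d 1
  | k + 3 => (nodeIndex t p d (k + 2) + 1) + gapOffset t p d (nodeIndex t p d (k + 2) + 1)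

/-- `T_k = t_{j_k}`, for `k ≥ 1`. -/
def node (t : ℕ → ℝ) (p : ℕ) (d : ℝ) (k : ℕ) : ℝ := t (nodeIndex t p d k)

/-- Left end point of the interval `F_k`, `k ≥ 1`. -/
def leftEnd (t : ℕ → ℝ) (p : ℕ) (d : ℝ) (k : ℕ) : ℝ :=
  if k = 1 then node t p d 1 - d / (2 * p) else node t p d k + d / (2 * p)

/-- Right end point of the interval `F_k`, `k ≥ 1`. -/
def rightEnd (t : ℕ → ℝ) (p : ℕ) (d : ℝ) (k : ℕ) : ℝ := node t p d (k + 1) + d / (2 * p)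

/-- The box `Π_k = {a + ib : a ∈ F_k, |b| ≤ d / (2p)}`, `k ≥ 1`. -/
def box (t : ℕ → ℝ) (p : ℕ) (d : ℝ) (k : ℕ) : Set ℂ :=
  rect (leftEnd t p d k) (rightEnd t p d k) (-(d / (2 * p))) (d / (2 * p))

/-- The rectangle `Π_0 = {a + ib : min(T_1, 0) - h ≤ a ≤ T_{K+1} + d / (2p), |b| ≤ h}`. -/
def bigBox (t : ℕ → ℝ) (p : ℕ) (d : ℝ) (K : ℕ) (h : ℝ) : Set ℂ :=
  rect (min (node t p d 1) 0 - h) (node t p d (K + 1) + d / (2 * p)) (-h) h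

section Projections

variable {H : Type*} [NormedAddCommGroup H] [InnerProductSpace ℂ H]

/-- `(1 / 2πi) ∫ (z - A)⁻¹ dz` over `Γ_k = ∂Π_k`, `k ≥ 1`. -/
def boxProj (A : H →ₗ.[ℂ] H) (t : ℕ → ℝ) (p : ℕ) (d : ℝ) (k : ℕ) : H →L[ℂ] H :=
  rieszIntegral A (leftEnd t p d k) (rightEnd t p d k) (-(d / (2 * p))) (d / (2 * p))

/-- `(1 / 2πi) ∫ (z - A)⁻¹ dz` over `Γ_0 = ∂Π_0`. -/
def bigBoxProj (A : H →ₗ.[ℂ] H) (t : ℕ → ℝ) (p : ℕ) (d : ℝ) (K : ℕ) (h : ℝ) : H →L[ℂ] H :=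
  rieszIntegral A (min (node t p d 1) 0 - h) (node t p d (K + 1) + d / (2 * p)) (-h) h

end Projections

end RootSystem

end

/-! Put δ = d/(2p) and C(z) = B(z - T)⁻¹. Since z - T - sB = (1 - sC(z))(z - T), the bound ‖C(z)‖ ≤
1/2 puts z in the resolvent set of T + sB for every s in [0, 1] and costs only a factor 2 in the
resolvent norm. The Hilbert–Schmidt bound gives ‖C(z)‖² ≤ ∑ β_k / |z - t_k|², so everything reduces
to showing that this sum is at most 1/4 on the contours and outside the boxes.

The eigenvalues fall into clusters of at most p points, with gaps of at least 2δ between clusters.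
The walls, placed δ to the right of each cluster, carry the vertical sides of the boxes. If Re z
lies between walls c and c + 1, cluster i is at distance at least δ|i - c|, so the sum is dominated
by p times a two-sided series (`sum_dist_le`). At height h, or to the left of the big box, the
condition on h gives 1/4 directly (`sum_div_sq_le_of_height`). To the right of wall K the sum splits
at k = M (`sum_div_sq_le_of_wall`): the tail has small β_k, while the clusters of the remaining k
are more than N places away, and each part is at most 1/8.

For the dimensions, the Riesz integral of T + sB is idempotent and Lipschitz in s. Projections less
than 1 apart in norm have equal rank, so the rank at s = 1 is the rank at s = 0
(`rangeDim_rieszIntegral_add`), and for T it is the number of eigenvalues enclosed. -/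

namespace RootSystem

/-! ### Resolvents of unbounded operators -/

section ResolventAlgebra

variable {H : Type*} [NormedAddCommGroup H] [InnerProductSpace ℂ H]

theorem IsResolventAt.unique {A : H →ₗ.[ℂ] H} {z : ℂ} {R S : H →L[ℂ] H}
    (hR : IsResolventAt A z R) (hS : IsResolventAt A z S) : R = S := by
  ext f
  obtain ⟨hf, e⟩ := hS.1 f
  have := hR.2 ⟨S f, hf⟩
  rwa [e] at this

theorem IsResolventAt.mem {A : H →ₗ.[ℂ] H} {z : ℂ} {R : H →L[ℂ] H}
    (hR : IsResolventAt A z R) : z ∈ resolventSet A := ⟨R, hR⟩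

theorem isResolventAt_resolventOp {A : H →ₗ.[ℂ] H} {z : ℂ} (hz : z ∈ resolventSet A) :
    IsResolventAt A z (resolventOp A z) := by
  have hz' : ∃ R : H →L[ℂ] H, IsResolventAt A z R := hz
  rw [resolventOp, dif_pos hz']
  exact hz'.choose_spec

theorem IsResolventAt.resolventOp_eq {A : H →ₗ.[ℂ] H} {z : ℂ} {R : H →L[ℂ] H}
    (hR : IsResolventAt A z R) : resolventOp A z = R :=
  (isResolventAt_resolventOp hR.mem).unique hR

/-- The first resolvent identity. -/
theorem IsResolventAt.sub_eq {A : H →ₗ.[ℂ] H} {z w : ℂ} {R S : H →L[ℂ] H}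
    (hR : IsResolventAt A z R) (hS : IsResolventAt A w S) : R - S = (w - z) • (R * S) := by
  ext f
  obtain ⟨hf, e⟩ := hS.1 f
  have h1 := hR.2 ⟨S f, hf⟩
  have h2 : f = (w - z) • S f + (z • S f - A ⟨S f, hf⟩) := by
    rw [sub_smul]; nth_rewrite 1 [← e]; abel
  have h3 : R f = (w - z) • R (S f) + S f := by
    nth_rewrite 1 [h2]
    rw [map_add, h1, map_smul]
  simp [h3]

/-- If `(w - A') R` is invertible for a resolvent `R` of an operator with the same domain, then
`w` is in the resolvent set of `A'`. -/
theorem IsResolventAt.mul_inv {A A' : H →ₗ.[ℂ] H} {z w : ℂ} {R : H →L[ℂ] H}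
    (hR : IsResolventAt A z R) (hdom : A'.domain ≤ A.domain) (U : (H →L[ℂ] H)ˣ)
    (hU : ∀ f, ∃ hf : R f ∈ A'.domain, w • R f - A' ⟨R f, hf⟩ = (U : H →L[ℂ] H) f) :
    IsResolventAt A' w (R * (↑U⁻¹ : H →L[ℂ] H)) := by
  have hUi : ∀ f, (U : H →L[ℂ] H) ((↑U⁻¹ : H →L[ℂ] H) f) = f := fun f => by
    rw [← mul_apply_eq_comp, Units.mul_inv]; rfl
  have hiU : ∀ f, (↑U⁻¹ : H →L[ℂ] H) ((U : H →L[ℂ] H) f) = f := fun f => by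
    rw [← mul_apply_eq_comp, Units.inv_mul]; rfl
  refine ⟨fun f => ?_, fun x => ?_⟩
  · obtain ⟨hf, e⟩ := hU ((↑U⁻¹ : H →L[ℂ] H) f)
    exact ⟨hf, by rw [hUi] at e; exact e⟩
  · have hx := hR.2 ⟨x, hdom x.2⟩
    set g := z • (x : H) - A ⟨x, hdom x.2⟩
    obtain ⟨hf, e⟩ := hU g
    have hxe : (⟨R g, hf⟩ : A'.domain) = x := Subtype.ext hx
    rw [hxe] at e
    have hx' : R g = (x : H) := hx
    rw [hx'] at e
    rw [e, mul_apply_eq_comp, hiU]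
    exact hx

/-- This is the factorization w - A = (1 + (w - z)R)(z - A). It makes the resolvent near z an
explicit function of w, whence the resolvent set is open and the resolvent holomorphic. -/
theorem IsResolventAt.shift {A : H →ₗ.[ℂ] H} {z w : ℂ} {R : H →L[ℂ] H}
    (hR : IsResolventAt A z R) (hU : IsUnit (1 + (w - z) • R)) :
    IsResolventAt A w (R * Ring.inverse (1 + (w - z) • R)) := by
  obtain ⟨U, hU⟩ := hU
  rw [← hU, Ring.inverse_unit]
  refine hR.mul_inv le_rfl U fun f => ?_
  obtain ⟨hf, e⟩ := hR.1 f
  refine ⟨hf, ?_⟩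
  rw [hU]
  have : (1 + (w - z) • R) f = f + (w - z) • R f := rfl
  rw [this, sub_smul]
  nth_rewrite 3 [← e]
  abel

variable [CompleteSpace H]

theorem eventually_isUnit_one_add_smul (R : H →L[ℂ] H) (z : ℂ) :
    ∀ᶠ w in nhds z, IsUnit (1 + (w - z) • R) := by
  have hc : ContinuousAt (fun w : ℂ => 1 + (w - z) • R) z := by fun_prop
  have : (fun w : ℂ => 1 + (w - z) • R) z = 1 := by simp
  exact hc.eventually (by rw [this]; exact Units.isOpen.mem_nhds isUnit_one)

theorem isOpen_resolventSet (A : H →ₗ.[ℂ] H) : IsOpen (resolventSet A) := by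
  rw [isOpen_iff_mem_nhds]
  rintro z ⟨R, hR⟩
  filter_upwards [eventually_isUnit_one_add_smul R z] with w hw
  exact (hR.shift hw).mem

theorem differentiableAt_resolventOp {A : H →ₗ.[ℂ] H} {z : ℂ} (hz : z ∈ resolventSet A) :
    DifferentiableAt ℂ (resolventOp A) z := by
  obtain ⟨R, hR⟩ := hz
  have h1 : resolventOp A =ᶠ[nhds z] fun w => R * Ring.inverse (1 + (w - z) • R) := by
    filter_upwards [eventually_isUnit_one_add_smul R z] with w hw
    exact (hR.shift hw).resolventOp_eq
  refine DifferentiableAt.congr_of_eventuallyEq ?_ h1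
  refine (differentiableAt_const R).mul (DifferentiableAt.inverse ?_ ?_)
  · fun_prop
  · simp

/-- `(1 - C)⁻¹` for `‖C‖ ≤ 1/2` has norm at most `2`. -/
theorem exists_units_one_sub {C : H →L[ℂ] H} (hC : ‖C‖ ≤ 1 / 2) :
    ∃ U : (H →L[ℂ] H)ˣ, (U : H →L[ℂ] H) = 1 - C ∧ ‖(↑U⁻¹ : H →L[ℂ] H)‖ ≤ 2 := by
  refine ⟨Units.oneSub C (by linarith), rfl, ?_⟩
  set U := Units.oneSub C (by linarith)
  -- V = 1 + CV gives ‖V‖ ≤ 1 + ‖V‖/2, without summing the Neumann series.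
  have h1 : (↑U⁻¹ : H →L[ℂ] H) = 1 + C * (↑U⁻¹ : H →L[ℂ] H) := by
    have h2 : (1 - C) * (↑U⁻¹ : H →L[ℂ] H) = 1 := U.mul_inv
    rw [sub_mul, one_mul] at h2
    rw [← h2]; abel
  have h3 : ‖(↑U⁻¹ : H →L[ℂ] H)‖ ≤ 1 + 1 / 2 * ‖(↑U⁻¹ : H →L[ℂ] H)‖ := by
    nth_rewrite 1 [h1]
    refine (norm_add_le _ _).trans (add_le_add ContinuousLinearMap.norm_id_le ?_)
    exact (norm_mul_le _ _).trans (by gcongr)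
  linarith

end ResolventAlgebra

/-! ### Contour integrals over rectangles -/

section BoundaryIntegral

/-- The four sides of a rectangle. -/
def rectSides (a₁ a₂ b₁ b₂ : ℝ) : Set ℂ :=
  {z | z ∈ rect a₁ a₂ b₁ b₂ ∧ (z.re = a₁ ∨ z.re = a₂ ∨ z.im = b₁ ∨ z.im = b₂)}

theorem rect_eq_reProdIm (a₁ a₂ b₁ b₂ : ℝ) :
    rect a₁ a₂ b₁ b₂ = Set.Icc a₁ a₂ ×ℂ Set.Icc b₁ b₂ := rfl

theorem isCompact_rect (a₁ a₂ b₁ b₂ : ℝ) : IsCompact (rect a₁ a₂ b₁ b₂) :=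
  isCompact_Icc.reProdIm isCompact_Icc

theorem isCompact_rectSides (a₁ a₂ b₁ b₂ : ℝ) : IsCompact (rectSides a₁ a₂ b₁ b₂) := by
  refine (isCompact_rect a₁ a₂ b₁ b₂).inter_right (t := {z : ℂ | _}) ?_
  exact ((isClosed_eq Complex.continuous_re continuous_const).union
    ((isClosed_eq Complex.continuous_re continuous_const).union
    ((isClosed_eq Complex.continuous_im continuous_const).union
    (isClosed_eq Complex.continuous_im continuous_const))))

theorem frontier_rect_subset (a₁ a₂ b₁ b₂ : ℝ) :
    frontier (rect a₁ a₂ b₁ b₂) ⊆ rectSides a₁ a₂ b₁ b₂ := by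
  intro z hz
  have hz1 : z ∈ rect a₁ a₂ b₁ b₂ := (isCompact_rect a₁ a₂ b₁ b₂).isClosed.frontier_subset hz
  refine ⟨hz1, ?_⟩
  by_contra! hc
  refine hz.2 ?_
  rw [rect_eq_reProdIm, Complex.interior_reProdIm, interior_Icc, interior_Icc]
  exact ⟨⟨lt_of_le_of_ne hz1.1.1 (Ne.symm hc.1), lt_of_le_of_ne hz1.1.2 hc.2.1⟩,
    ⟨lt_of_le_of_ne hz1.2.1 (Ne.symm hc.2.2.1), lt_of_le_of_ne hz1.2.2 hc.2.2.2⟩⟩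

/-- The factor `dz / dx` on each side of a rectangle, with the sign of the orientation. -/
noncomputable def sideCoeff : Fin 4 → ℂ := ![1, -1, Complex.I, -Complex.I]

/-- The lower ends of the parameter intervals of the sides of a rectangle. -/
def sideLower (a₁ b₁ : ℝ) : Fin 4 → ℝ := ![a₁, a₁, b₁, b₁]

/-- The upper ends of the parameter intervals of the sides of a rectangle. -/
def sideUpper (a₂ b₂ : ℝ) : Fin 4 → ℝ := ![a₂, a₂, b₂, b₂]

/-- Parametrizations of the sides of a rectangle: bottom, top, right, left. -/
noncomputable def sidePath (a₁ a₂ b₁ b₂ : ℝ) : Fin 4 → ℝ → ℂ :=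
  ![fun x => x + b₁ * Complex.I, fun x => x + b₂ * Complex.I,
    fun y => a₂ + y * Complex.I, fun y => a₁ + y * Complex.I]

theorem continuous_sidePath (a₁ a₂ b₁ b₂ : ℝ) (i : Fin 4) :
    Continuous (sidePath a₁ a₂ b₁ b₂ i) := by
  fin_cases i <;> simp [sidePath] <;> fun_prop

theorem norm_sideCoeff (i : Fin 4) : ‖sideCoeff i‖ = 1 := by
  fin_cases i <;> simp [sideCoeff]

variable {E F : Type*} [NormedAddCommGroup E] [NormedSpace ℂ E]
  [NormedAddCommGroup F] [NormedSpace ℂ F] {a₁ a₂ b₁ b₂ : ℝ}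

theorem sideLower_le_sideUpper (ha : a₁ ≤ a₂) (hb : b₁ ≤ b₂) (i : Fin 4) :
    sideLower a₁ b₁ i ≤ sideUpper a₂ b₂ i := by
  fin_cases i <;> simpa [sideLower, sideUpper]

theorem sidePath_mem (ha : a₁ ≤ a₂) (hb : b₁ ≤ b₂) (i : Fin 4) {x : ℝ}
    (hx : x ∈ Set.Icc (sideLower a₁ b₁ i) (sideUpper a₂ b₂ i)) :
    sidePath a₁ a₂ b₁ b₂ i x ∈ rectSides a₁ a₂ b₁ b₂ := by
  obtain ⟨h1, h2⟩ := hx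
  fin_cases i <;> simp [sidePath, sideLower, sideUpper, rectSides, rect] at h1 h2 ⊢ <;>
    simp [*]

/-- The integral over the boundary of a rectangle, counterclockwise. -/
noncomputable def boundaryIntegral (f : ℂ → E) (a₁ a₂ b₁ b₂ : ℝ) : E :=
  ∑ i : Fin 4, sideCoeff i •
    ∫ x in sideLower a₁ b₁ i..sideUpper a₂ b₂ i, f (sidePath a₁ a₂ b₁ b₂ i x)

theorem boundaryIntegral_eq (f : ℂ → E) (a₁ a₂ b₁ b₂ : ℝ) :
    boundaryIntegral f a₁ a₂ b₁ b₂ =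
      (∫ x : ℝ in a₁..a₂, f (x + b₁ * Complex.I)) - (∫ x : ℝ in a₁..a₂, f (x + b₂ * Complex.I))
        + Complex.I • (∫ y : ℝ in b₁..b₂, f (a₂ + y * Complex.I))
        - Complex.I • (∫ y : ℝ in b₁..b₂, f (a₁ + y * Complex.I)) := by
  simp [boundaryIntegral, Fin.sum_univ_four, sideCoeff, sideLower, sideUpper, sidePath,
    sub_eq_add_neg]

theorem intervalIntegrable_side {G : Type*} [NormedAddCommGroup G] (ha : a₁ ≤ a₂) (hb : b₁ ≤ b₂)
    {f : ℂ → G}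
    (hf : ContinuousOn f (rectSides a₁ a₂ b₁ b₂)) (i : Fin 4) :
    IntervalIntegrable (fun x => f (sidePath a₁ a₂ b₁ b₂ i x)) MeasureTheory.volume
      (sideLower a₁ b₁ i) (sideUpper a₂ b₂ i) := by
  refine ContinuousOn.intervalIntegrable ?_
  rw [Set.uIcc_of_le (sideLower_le_sideUpper ha hb i)]
  exact hf.comp (continuous_sidePath a₁ a₂ b₁ b₂ i).continuousOn
    fun x hx => sidePath_mem ha hb i hx

theorem boundaryIntegral_congr (ha : a₁ ≤ a₂) (hb : b₁ ≤ b₂) {f g : ℂ → E}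
    (hfg : Set.EqOn f g (rectSides a₁ a₂ b₁ b₂)) :
    boundaryIntegral f a₁ a₂ b₁ b₂ = boundaryIntegral g a₁ a₂ b₁ b₂ := by
  refine Finset.sum_congr rfl fun i _ => ?_
  congr 1
  refine intervalIntegral.integral_congr fun x hx => hfg (sidePath_mem ha hb i ?_)
  rwa [Set.uIcc_of_le (sideLower_le_sideUpper ha hb i)] at hx

theorem boundaryIntegral_sub (ha : a₁ ≤ a₂) (hb : b₁ ≤ b₂) {f g : ℂ → E}
    (hf : ContinuousOn f (rectSides a₁ a₂ b₁ b₂)) (hg : ContinuousOn g (rectSides a₁ a₂ b₁ b₂)) :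
    boundaryIntegral (fun z => f z - g z) a₁ a₂ b₁ b₂ =
      boundaryIntegral f a₁ a₂ b₁ b₂ - boundaryIntegral g a₁ a₂ b₁ b₂ := by
  rw [boundaryIntegral, boundaryIntegral, boundaryIntegral, ← Finset.sum_sub_distrib]
  refine Finset.sum_congr rfl fun i _ => ?_
  rw [intervalIntegral.integral_sub (intervalIntegrable_side ha hb hf i)
    (intervalIntegrable_side ha hb hg i), smul_sub]

theorem boundaryIntegral_comp [CompleteSpace E] [CompleteSpace F] (L : E →L[ℂ] F)
    (ha : a₁ ≤ a₂) (hb : b₁ ≤ b₂) {f : ℂ → E}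
    (hf : ContinuousOn f (rectSides a₁ a₂ b₁ b₂)) :
    boundaryIntegral (fun z => L (f z)) a₁ a₂ b₁ b₂ = L (boundaryIntegral f a₁ a₂ b₁ b₂) := by
  rw [boundaryIntegral, boundaryIntegral, map_sum]
  refine Finset.sum_congr rfl fun i _ => ?_
  rw [map_smul, L.intervalIntegral_comp_comm (intervalIntegrable_side ha hb hf i)]

theorem norm_boundaryIntegral_le (ha : a₁ ≤ a₂) (hb : b₁ ≤ b₂) {f : ℂ → E} {C : ℝ}
    (hf : ∀ z ∈ rectSides a₁ a₂ b₁ b₂, ‖f z‖ ≤ C) :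
    ‖boundaryIntegral f a₁ a₂ b₁ b₂‖ ≤ C * (2 * (a₂ - a₁) + 2 * (b₂ - b₁)) := by
  have h1 : ∀ i : Fin 4, ‖sideCoeff i •
      ∫ x in sideLower a₁ b₁ i..sideUpper a₂ b₂ i, f (sidePath a₁ a₂ b₁ b₂ i x)‖ ≤
      C * (sideUpper a₂ b₂ i - sideLower a₁ b₁ i) := by
    intro i
    have hle := sideLower_le_sideUpper ha hb i
    rw [norm_smul, norm_sideCoeff, one_mul, ← abs_of_nonneg (sub_nonneg.2 hle)]
    refine intervalIntegral.norm_integral_le_of_norm_le_const fun x hx => ?_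
    rw [Set.uIoc_of_le hle] at hx
    exact hf _ (sidePath_mem ha hb i ⟨hx.1.le, hx.2⟩)
  refine (norm_sum_le_of_le _ fun i _ => h1 i).trans (le_of_eq ?_)
  simp [Fin.sum_univ_four, sideLower, sideUpper]
  ring

/-- Fubini on each of the sixteen pairs of sides. It serves the double contour integral behind
idempotence. -/
theorem boundaryIntegral_swap {a₁' a₂' b₁' b₂' : ℝ} (ha : a₁ ≤ a₂) (hb : b₁ ≤ b₂)
    (ha' : a₁' ≤ a₂') (hb' : b₁' ≤ b₂') {f : ℂ → ℂ → E}
    (hf : ContinuousOn (Function.uncurry f)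
      (rectSides a₁ a₂ b₁ b₂ ×ˢ rectSides a₁' a₂' b₁' b₂')) :
    boundaryIntegral (fun z => boundaryIntegral (fun w => f z w) a₁' a₂' b₁' b₂') a₁ a₂ b₁ b₂ =
      boundaryIntegral (fun w => boundaryIntegral (fun z => f z w) a₁ a₂ b₁ b₂)
        a₁' a₂' b₁' b₂' := by
  have hint : ∀ i j : Fin 4, MeasureTheory.IntegrableOn
      (Function.uncurry fun x y => f (sidePath a₁ a₂ b₁ b₂ i x) (sidePath a₁' a₂' b₁' b₂' j y))
      (Set.uIoc (sideLower a₁ b₁ i) (sideUpper a₂ b₂ i) ×ˢ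
        Set.uIoc (sideLower a₁' b₁' j) (sideUpper a₂' b₂' j)) := by
    intro i j
    rw [Set.uIoc_of_le (sideLower_le_sideUpper ha hb i),
      Set.uIoc_of_le (sideLower_le_sideUpper ha' hb' j)]
    refine MeasureTheory.IntegrableOn.mono_set (ContinuousOn.integrableOn_compact
      (isCompact_Icc.prod isCompact_Icc) ?_)
      (Set.prod_mono Set.Ioc_subset_Icc_self Set.Ioc_subset_Icc_self)
    exact hf.comp (((continuous_sidePath a₁ a₂ b₁ b₂ i).comp continuous_fst).prodMk
      ((continuous_sidePath a₁' a₂' b₁' b₂' j).comp continuous_snd)).continuousOn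
      fun x hx => ⟨sidePath_mem ha hb i hx.1, sidePath_mem ha' hb' j hx.2⟩
  have hint1 : ∀ i j : Fin 4, IntervalIntegrable
      (fun x => ∫ y in sideLower a₁' b₁' j..sideUpper a₂' b₂' j,
        f (sidePath a₁ a₂ b₁ b₂ i x) (sidePath a₁' a₂' b₁' b₂' j y)) MeasureTheory.volume
      (sideLower a₁ b₁ i) (sideUpper a₂ b₂ i) := by
    intro i j
    have h := hint i j
    rw [intervalIntegrable_iff]
    simp_rw [intervalIntegral.integral_of_le (sideLower_le_sideUpper ha' hb' j)]
    rw [Set.uIoc_of_le (sideLower_le_sideUpper ha' hb' j), MeasureTheory.IntegrableOn,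
      MeasureTheory.Measure.volume_eq_prod, ← MeasureTheory.Measure.prod_restrict] at h
    exact h.integral_prod_left
  have hint2 : ∀ i j : Fin 4, IntervalIntegrable
      (fun y => ∫ x in sideLower a₁ b₁ i..sideUpper a₂ b₂ i,
        f (sidePath a₁ a₂ b₁ b₂ i x) (sidePath a₁' a₂' b₁' b₂' j y)) MeasureTheory.volume
      (sideLower a₁' b₁' j) (sideUpper a₂' b₂' j) := by
    intro i j
    have h := hint i j
    rw [intervalIntegrable_iff]
    simp_rw [intervalIntegral.integral_of_le (sideLower_le_sideUpper ha hb i)]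
    rw [Set.uIoc_of_le (sideLower_le_sideUpper ha hb i), MeasureTheory.IntegrableOn,
      MeasureTheory.Measure.volume_eq_prod, ← MeasureTheory.Measure.prod_restrict] at h
    exact h.integral_prod_right
  have h1 : ∀ i : Fin 4, ∫ x in sideLower a₁ b₁ i..sideUpper a₂ b₂ i,
      ∑ j : Fin 4, sideCoeff j • ∫ y in sideLower a₁' b₁' j..sideUpper a₂' b₂' j,
        f (sidePath a₁ a₂ b₁ b₂ i x) (sidePath a₁' a₂' b₁' b₂' j y) =
      ∑ j : Fin 4, sideCoeff j • ∫ x in sideLower a₁ b₁ i..sideUpper a₂ b₂ i,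
        ∫ y in sideLower a₁' b₁' j..sideUpper a₂' b₂' j,
        f (sidePath a₁ a₂ b₁ b₂ i x) (sidePath a₁' a₂' b₁' b₂' j y) := fun i => by
    refine (intervalIntegral.integral_finsetSum fun j _ =>
      (hint1 i j).smul (sideCoeff j)).trans ?_
    simp only [Pi.smul_apply, intervalIntegral.integral_smul]
  have h2 : ∀ j : Fin 4, ∫ y in sideLower a₁' b₁' j..sideUpper a₂' b₂' j,
      ∑ i : Fin 4, sideCoeff i • ∫ x in sideLower a₁ b₁ i..sideUpper a₂ b₂ i,
        f (sidePath a₁ a₂ b₁ b₂ i x) (sidePath a₁' a₂' b₁' b₂' j y) =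
      ∑ i : Fin 4, sideCoeff i • ∫ y in sideLower a₁' b₁' j..sideUpper a₂' b₂' j,
        ∫ x in sideLower a₁ b₁ i..sideUpper a₂ b₂ i,
        f (sidePath a₁ a₂ b₁ b₂ i x) (sidePath a₁' a₂' b₁' b₂' j y) := fun j => by
    refine (intervalIntegral.integral_finsetSum fun i _ =>
      (hint2 i j).smul (sideCoeff i)).trans ?_
    simp only [Pi.smul_apply, intervalIntegral.integral_smul]
  simp only [boundaryIntegral, h1, h2, Finset.smul_sum]
  rw [Finset.sum_comm]
  refine Finset.sum_congr rfl fun j _ => Finset.sum_congr rfl fun i _ => ?_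
  rw [smul_comm, MeasureTheory.intervalIntegral_intervalIntegral_swap (hint i j)]

theorem boundaryIntegral_eq_zero (ha : a₁ ≤ a₂) (hb : b₁ ≤ b₂) {f : ℂ → E}
    (hf : ∀ z ∈ rect a₁ a₂ b₁ b₂, DifferentiableAt ℂ f z) :
    boundaryIntegral f a₁ a₂ b₁ b₂ = 0 := by
  have h := Complex.integral_boundary_rect_eq_zero_of_differentiableOn f (⟨a₁, b₁⟩ : ℂ) ⟨a₂, b₂⟩ ?_
  · rw [boundaryIntegral_eq]
    exact h
  · simp only [Set.uIcc_of_le ha, Set.uIcc_of_le hb]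
    exact fun z hz => (hf z hz).differentiableWithinAt

/-- The common side is traversed in both directions and cancels whatever `f` does there; continuity
is needed only to split the horizontal sides. -/
theorem boundaryIntegral_add_horizontal {a₃ : ℝ} (h12 : a₁ ≤ a₂) (h23 : a₂ ≤ a₃) {f : ℂ → E}
    (h₁ : ∀ x ∈ Set.Icc a₁ a₃, ContinuousAt f (x + b₁ * Complex.I))
    (h₂ : ∀ x ∈ Set.Icc a₁ a₃, ContinuousAt f (x + b₂ * Complex.I)) :
    boundaryIntegral f a₁ a₃ b₁ b₂ =
      boundaryIntegral f a₁ a₂ b₁ b₂ + boundaryIntegral f a₂ a₃ b₁ b₂ := by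
  have key : ∀ b u v : ℝ, (∀ x ∈ Set.Icc a₁ a₃, ContinuousAt f (x + b * Complex.I)) →
      u ≤ v → a₁ ≤ u → v ≤ a₃ → IntervalIntegrable (fun x : ℝ => f (x + b * Complex.I))
        MeasureTheory.volume u v := by
    intro b u v hc huv hu hv
    refine ContinuousOn.intervalIntegrable fun x hx => ContinuousAt.continuousWithinAt ?_
    rw [Set.uIcc_of_le huv] at hx
    exact ContinuousAt.comp (f := fun x : ℝ => (x + b * Complex.I : ℂ))
      (hc x ⟨hu.trans hx.1, hx.2.trans hv⟩) (by fun_prop)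
  simp only [boundaryIntegral_eq]
  rw [← intervalIntegral.integral_add_adjacent_intervals (key b₁ a₁ a₂ h₁ h12 le_rfl h23)
    (key b₁ a₂ a₃ h₁ h23 h12 le_rfl),
    ← intervalIntegral.integral_add_adjacent_intervals (key b₂ a₁ a₂ h₂ h12 le_rfl h23)
    (key b₂ a₂ a₃ h₂ h23 h12 le_rfl)]
  abel

theorem boundaryIntegral_add_vertical {b₃ : ℝ} (h12 : b₁ ≤ b₂) (h23 : b₂ ≤ b₃) {f : ℂ → E}
    (h₁ : ∀ y ∈ Set.Icc b₁ b₃, ContinuousAt f (a₁ + y * Complex.I))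
    (h₂ : ∀ y ∈ Set.Icc b₁ b₃, ContinuousAt f (a₂ + y * Complex.I)) :
    boundaryIntegral f a₁ a₂ b₁ b₃ =
      boundaryIntegral f a₁ a₂ b₁ b₂ + boundaryIntegral f a₁ a₂ b₂ b₃ := by
  have key : ∀ a u v : ℝ, (∀ y ∈ Set.Icc b₁ b₃, ContinuousAt f (a + y * Complex.I)) →
      u ≤ v → b₁ ≤ u → v ≤ b₃ → IntervalIntegrable (fun y : ℝ => f (a + y * Complex.I))
        MeasureTheory.volume u v := by
    intro a u v hc huv hu hv
    refine ContinuousOn.intervalIntegrable fun x hx => ContinuousAt.continuousWithinAt ?_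
    rw [Set.uIcc_of_le huv] at hx
    exact ContinuousAt.comp (f := fun x : ℝ => (a + x * Complex.I : ℂ))
      (hc x ⟨hu.trans hx.1, hx.2.trans hv⟩) (by fun_prop)
  simp only [boundaryIntegral_eq]
  rw [← intervalIntegral.integral_add_adjacent_intervals (key a₁ b₁ b₂ h₁ h12 le_rfl h23)
    (key a₁ b₂ b₃ h₁ h23 h12 le_rfl),
    ← intervalIntegral.integral_add_adjacent_intervals (key a₂ b₁ b₂ h₂ h12 le_rfl h23)
    (key a₂ b₂ b₃ h₂ h23 h12 le_rfl)]
  simp only [smul_add]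
  abel

/-- The rectangle may be enlarged if `f` is holomorphic near the region that is added. -/
theorem boundaryIntegral_enlarge {a₁' a₂' b₁' b₂' : ℝ} (ha : a₁ ≤ a₂) (hb : b₁ ≤ b₂)
    (ha₁ : a₁' ≤ a₁) (ha₂ : a₂ ≤ a₂') (hb₁ : b₁' ≤ b₁) (hb₂ : b₂ ≤ b₂') {f : ℂ → E}
    (hf : ∀ z ∈ rect a₁' a₂' b₁' b₂',
      (z.re ≤ a₁ ∨ a₂ ≤ z.re ∨ z.im ≤ b₁ ∨ b₂ ≤ z.im) → DifferentiableAt ℂ f z) :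
    boundaryIntegral f a₁' a₂' b₁' b₂' = boundaryIntegral f a₁ a₂ b₁ b₂ := by
  have hc : ∀ x y : ℝ, a₁' ≤ x → x ≤ a₂' → b₁' ≤ y → y ≤ b₂' →
      (x ≤ a₁ ∨ a₂ ≤ x ∨ y ≤ b₁ ∨ b₂ ≤ y) → ContinuousAt f (x + y * Complex.I) := by
    intro x y h1 h2 h3 h4 h5
    refine (hf _ ⟨⟨?_, ?_⟩, ⟨?_, ?_⟩⟩ ?_).continuousAt <;> simpa
  have hz : ∀ u v s t : ℝ, u ≤ v → s ≤ t → a₁' ≤ u → v ≤ a₂' → b₁' ≤ s → t ≤ b₂' →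
      (v ≤ a₁ ∨ a₂ ≤ u ∨ t ≤ b₁ ∨ b₂ ≤ s) → boundaryIntegral f u v s t = 0 := by
    intro u v s t huv hst h1 h2 h3 h4 h5
    refine boundaryIntegral_eq_zero huv hst fun z hz => hf z ?_ ?_
    · exact ⟨⟨h1.trans hz.1.1, hz.1.2.trans h2⟩, ⟨h3.trans hz.2.1, hz.2.2.trans h4⟩⟩
    · rcases h5 with h | h | h | h
      · exact Or.inl (hz.1.2.trans h)
      · exact Or.inr (Or.inl (h.trans hz.1.1))
      · exact Or.inr (Or.inr (Or.inl (hz.2.2.trans h)))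
      · exact Or.inr (Or.inr (Or.inr (h.trans hz.2.1)))
  -- The bottom, top, left and right strips are cut off in turn; each contributes zero by Cauchy's
  -- theorem.
  have e1 : boundaryIntegral f a₁' a₂' b₁' b₂' = boundaryIntegral f a₁' a₂' b₁ b₂' := by
    rw [boundaryIntegral_add_vertical hb₁ (hb.trans hb₂)
      (fun y hy => hc _ y le_rfl (by linarith) hy.1 hy.2 (Or.inl ha₁))
      (fun y hy => hc _ y (by linarith) le_rfl hy.1 hy.2 (Or.inr (Or.inl ha₂))),
      hz a₁' a₂' b₁' b₁ (by linarith) hb₁ le_rfl le_rfl le_rfl (by linarith) (by simp), zero_add]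
  have e2 : boundaryIntegral f a₁' a₂' b₁ b₂' = boundaryIntegral f a₁' a₂' b₁ b₂ := by
    rw [boundaryIntegral_add_vertical hb hb₂
      (fun y hy => hc _ y le_rfl (by linarith) (hb₁.trans hy.1) hy.2 (Or.inl ha₁))
      (fun y hy => hc _ y (by linarith) le_rfl (hb₁.trans hy.1) hy.2 (Or.inr (Or.inl ha₂))),
      hz a₁' a₂' b₂ b₂' (by linarith) hb₂ le_rfl le_rfl (by linarith) le_rfl (by simp), add_zero]
  have e3 : boundaryIntegral f a₁' a₂' b₁ b₂ = boundaryIntegral f a₁ a₂' b₁ b₂ := by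
    rw [boundaryIntegral_add_horizontal ha₁ (ha.trans ha₂)
      (fun x hx => hc x _ hx.1 hx.2 hb₁ (by linarith) (by simp))
      (fun x hx => hc x _ hx.1 hx.2 (by linarith) hb₂ (by simp)),
      hz a₁' a₁ b₁ b₂ ha₁ hb le_rfl (by linarith) hb₁ hb₂ (by simp), zero_add]
  have e4 : boundaryIntegral f a₁ a₂' b₁ b₂ = boundaryIntegral f a₁ a₂ b₁ b₂ := by
    rw [boundaryIntegral_add_horizontal ha ha₂
      (fun x hx => hc x _ (ha₁.trans hx.1) hx.2 hb₁ (by linarith) (by simp))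
      (fun x hx => hc x _ (ha₁.trans hx.1) hx.2 (by linarith) hb₂ (by simp)),
      hz a₂ a₂' b₁ b₂ ha₂ hb (by linarith) le_rfl hb₁ hb₂ (by simp), add_zero]
  rw [e1, e2, e3, e4]

/-- The argument of v is in (-π/2, π/2), so a quarter turn does not reach the branch cut. -/
theorem log_I_mul {v : ℂ} (hv : 0 < v.re) :
    Complex.log (Complex.I * v) = Complex.log v + Real.pi / 2 * Complex.I := by
  have hv0 : v ≠ 0 := fun h => by simp [h] at hv
  have h := abs_lt.1 (Complex.abs_arg_lt_pi_div_two_iff.2 (Or.inl hv))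
  rw [(Complex.log_mul_eq_add_log_iff Complex.I_ne_zero hv0).2, Complex.log_I, add_comm]
  rw [Complex.arg_I]
  constructor <;> linarith [Real.pi_pos]

/-- A rectangle winds once around the points of its interior. -/
theorem boundaryIntegral_inv_sub {w : ℂ} (ha₁ : a₁ < w.re) (ha₂ : w.re < a₂) (hb₁ : b₁ < w.im)
    (hb₂ : w.im < b₂) :
    boundaryIntegral (fun z => (z - w)⁻¹) a₁ a₂ b₁ b₂ = 2 * Real.pi * Complex.I := by
  -- On each side a rotation c moves c(z - w) into the right half plane, where its principal
  -- logarithm is a primitive of 1/(z - w).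
  have key : ∀ (c u v : ℂ) (s t : ℝ), s ≤ t → c ≠ 0 → v ≠ 0 →
      (∀ x ∈ Set.Icc s t, 0 < (c * (u + x * v - w)).re) →
      v * ∫ x in s..t, (u + x * v - w)⁻¹ =
        Complex.log (c * (u + t * v - w)) - Complex.log (c * (u + s * v - w)) := by
    intro c u v s t hst hc hv hpos
    have hne : ∀ x ∈ Set.Icc s t, u + x * v - w ≠ 0 := fun x hx h0 => by
      have := hpos x hx
      simp [h0] at this
    rw [← intervalIntegral.integral_const_mul]
    refine intervalIntegral.integral_eq_sub_of_hasDerivAt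
      (f := fun x : ℝ => Complex.log (c * (u + x * v - w))) (fun x hx => ?_) ?_
    · rw [Set.uIcc_of_le hst] at hx
      have h1 : HasDerivAt (fun x : ℝ => c * (u + x * v - w)) (c * v) x := by
        have h2 : HasDerivAt (fun x : ℝ => (x : ℂ)) 1 x := Complex.ofRealCLM.hasDerivAt
        simpa using ((h2.mul_const v).const_add u |>.sub_const w).const_mul c
      have h3 := h1.clog_real (Or.inl (hpos x hx))
      rw [mul_div_mul_left _ _ hc, div_eq_mul_inv] at h3
      exact h3
    · refine ContinuousOn.intervalIntegrable ?_
      rw [Set.uIcc_of_le hst]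
      refine ContinuousOn.mul continuousOn_const (ContinuousOn.inv₀ (by fun_prop) hne)
  have hI := Complex.I_ne_zero
  have k1 := key Complex.I (b₁ * Complex.I) 1 a₁ a₂ (by linarith) hI one_ne_zero
    (fun x hx => by simp; linarith)
  have k2 := key (-Complex.I) (b₂ * Complex.I) 1 a₁ a₂ (by linarith) (by simp) one_ne_zero
    (fun x hx => by simp; linarith)
  have k3 := key 1 a₂ Complex.I b₁ b₂ (by linarith) one_ne_zero hI
    (fun x hx => by simp; linarith)
  have k4 := key (-1) a₁ Complex.I b₁ b₂ (by linarith) (by simp) hI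
    (fun x hx => by simp; linarith)
  -- At each corner the primitives of the two adjacent sides differ by πi/2; the four corners add up
  -- to 2πi.
  have c1 := log_I_mul (v := a₂ + b₁ * Complex.I - w) (by simp; linarith)
  have c2 := log_I_mul (v := -Complex.I * (a₂ + b₂ * Complex.I - w)) (by simp; linarith)
  have c3 := log_I_mul (v := -(a₁ + b₂ * Complex.I - w)) (by simp; linarith)
  have c4 := log_I_mul (v := Complex.I * (a₁ + b₁ * Complex.I - w)) (by simp; linarith)
  have r : ∀ z : ℂ, Complex.I * (-Complex.I * z) = z := fun z => by
    rw [← mul_assoc]; simp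
  have r' : ∀ z : ℂ, Complex.I * (Complex.I * z) = -z := fun z => by
    rw [← mul_assoc]; simp
  have r'' : ∀ z : ℂ, Complex.I * -z = -Complex.I * z := fun z => by ring
  rw [r] at c2
  rw [r''] at c3
  rw [r'] at c4
  simp only [mul_one, one_mul, neg_one_mul] at k1 k2 k3 k4
  simp only [boundaryIntegral_eq, smul_eq_mul]
  rw [show (fun x : ℝ => ((x : ℂ) + b₁ * Complex.I - w)⁻¹) =
    fun x : ℝ => (b₁ * Complex.I + (x : ℂ) - w)⁻¹ by simp only [add_comm],
    show (fun x : ℝ => ((x : ℂ) + b₂ * Complex.I - w)⁻¹) =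
    fun x : ℝ => (b₂ * Complex.I + (x : ℂ) - w)⁻¹ by simp only [add_comm]]
  rw [k1, k2, k3, k4]
  simp only [add_comm (_ * Complex.I) (_ : ℂ)]
  linear_combination c1 + c2 + c3 + c4

end BoundaryIntegral

/-! ### Riesz projections and stability of their rank -/

section RieszProjections

variable {H : Type*} [NormedAddCommGroup H] [InnerProductSpace ℂ H]

theorem rieszIntegral_eq (A : H →ₗ.[ℂ] H) (a₁ a₂ b₁ b₂ : ℝ) :
    rieszIntegral A a₁ a₂ b₁ b₂ =
      (1 / (2 * (Real.pi : ℂ) * Complex.I)) • boundaryIntegral (resolventOp A) a₁ a₂ b₁ b₂ := by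
  rw [rieszIntegral, boundaryIntegral_eq]
  rfl

theorem two_pi_I_ne_zero : (2 * (Real.pi : ℂ) * Complex.I) ≠ 0 := by
  simp [Real.pi_ne_zero]

/-- A neighbourhood of the boundary of a rectangle contains a frame around the rectangle. -/
theorem exists_frame_subset {a₁ a₂ b₁ b₂ : ℝ} (ha : a₁ ≤ a₂) (hb : b₁ ≤ b₂) {W : Set ℂ}
    (hW : IsOpen W) (hΓ : rectSides a₁ a₂ b₁ b₂ ⊆ W) :
    ∃ ε > 0, ∀ z ∈ rect (a₁ - ε) (a₂ + ε) (b₁ - ε) (b₂ + ε),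
      (z.re ≤ a₁ ∨ a₂ ≤ z.re ∨ z.im ≤ b₁ ∨ b₂ ≤ z.im) → z ∈ W := by
  obtain ⟨η, hη, h⟩ := (isCompact_rectSides a₁ a₂ b₁ b₂).exists_cthickening_subset_open hW hΓ
  refine ⟨η / 2, by positivity, fun z hz hc => h ?_⟩
  obtain ⟨⟨h1, h2⟩, h3, h4⟩ := hz
  -- Clamping both coordinates to the rectangle gives a point on a side. Each coordinate moves by at
  -- most η/2, so the distance is at most η.
  refine Metric.mem_cthickening_of_dist_le z
    ⟨max a₁ (min a₂ z.re), max b₁ (min b₂ z.im)⟩ η _ ⟨⟨⟨?_, ?_⟩, ?_, ?_⟩, ?_⟩ ?_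
  · exact le_max_left _ _
  · exact max_le ha (min_le_left _ _)
  · exact le_max_left _ _
  · exact max_le hb (min_le_left _ _)
  · rcases hc with h | h | h | h
    · exact Or.inl (max_eq_left ((min_le_right _ _).trans h))
    · exact Or.inr (Or.inl (by simp [min_eq_left h, max_eq_right ha]))
    · exact Or.inr (Or.inr (Or.inl (max_eq_left ((min_le_right _ _).trans h))))
    · exact Or.inr (Or.inr (Or.inr (by simp [min_eq_left h, max_eq_right hb])))
  · rw [dist_eq_norm]
    refine (Complex.norm_le_abs_re_add_abs_im _).trans ?_
    have key : ∀ a b x : ℝ, a ≤ b → a - η / 2 ≤ x → x ≤ b + η / 2 →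
        |x - max a (min b x)| ≤ η / 2 := by
      intro a b x hab hx1 hx2
      rw [abs_le]
      rcases le_total b x with hx | hx <;> rcases le_total a x with hy | hy <;>
        simp only [min_eq_left, min_eq_right, max_eq_left, max_eq_right, hx, hy, hab] <;>
        constructor <;> linarith
    have e1 := key a₁ a₂ z.re ha h1 h2
    have e2 := key b₁ b₂ z.im hb h3 h4
    simp only [Complex.sub_re, Complex.sub_im]
    linarith

theorem continuousOn_resolventOp [CompleteSpace H] {A : H →ₗ.[ℂ] H} {s : Set ℂ}
    (hs : s ⊆ resolventSet A) : ContinuousOn (resolventOp A) s :=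
  fun _ hz => (differentiableAt_resolventOp (hs hz)).continuousAt.continuousWithinAt

/-- The Riesz integral over the boundary of a rectangle is a projection. -/
theorem rieszIntegral_mul_self [CompleteSpace H] (A : H →ₗ.[ℂ] H) {a₁ a₂ b₁ b₂ : ℝ}
    (ha : a₁ ≤ a₂) (hb : b₁ ≤ b₂) (hΓ : rectSides a₁ a₂ b₁ b₂ ⊆ resolventSet A) :
    rieszIntegral A a₁ a₂ b₁ b₂ * rieszIntegral A a₁ a₂ b₁ b₂ = rieszIntegral A a₁ a₂ b₁ b₂ := by
  obtain ⟨ε, hε, hframe⟩ := exists_frame_subset ha hb (isOpen_resolventSet A) hΓ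
  set R := resolventOp A with hRdef
  set Γ := rectSides a₁ a₂ b₁ b₂ with hΓdef
  set Γ' := rectSides (a₁ - ε) (a₂ + ε) (b₁ - ε) (b₂ + ε) with hΓ'def
  have ha' : a₁ - ε ≤ a₂ + ε := by linarith
  have hb' : b₁ - ε ≤ b₂ + ε := by linarith
  have hΓ' : Γ' ⊆ resolventSet A := fun z hz => hframe z hz.1 <| by
    rcases hz.2 with h | h | h | h
    · exact Or.inl (by linarith)
    · exact Or.inr (Or.inl (by linarith))
    · exact Or.inr (Or.inr (Or.inl (by linarith)))
    · exact Or.inr (Or.inr (Or.inr (by linarith)))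
  have hout : ∀ z ∈ rect a₁ a₂ b₁ b₂, ∀ w ∈ Γ', w - z ≠ 0 := by
    rintro z ⟨⟨h1, h2⟩, h3, h4⟩ w hw h0
    rw [sub_eq_zero] at h0
    subst h0
    rcases hw.2 with h | h | h | h <;> linarith
  have hRc := continuousOn_resolventOp hΓ
  have hRc' := continuousOn_resolventOp hΓ'
  have henl : boundaryIntegral R (a₁ - ε) (a₂ + ε) (b₁ - ε) (b₂ + ε) =
      boundaryIntegral R a₁ a₂ b₁ b₂ :=
    boundaryIntegral_enlarge ha hb (by linarith) (by linarith) (by linarith) (by linarith)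
      fun z hz h => differentiableAt_resolventOp (hframe z hz h)
  set Q := boundaryIntegral R a₁ a₂ b₁ b₂ with hQ
  set c : ℂ := 2 * (Real.pi : ℂ) * Complex.I with hc
  have hc0 : c ≠ 0 := two_pi_I_ne_zero
  set G : ℂ → H →L[ℂ] H := fun z =>
    boundaryIntegral (fun w => (w - z)⁻¹ • R w) (a₁ - ε) (a₂ + ε) (b₁ - ε) (b₂ + ε) with hG
  have hcG : ∀ z ∈ Γ, ContinuousOn (fun w => (w - z)⁻¹) Γ' := fun z hz =>
    ContinuousOn.inv₀ (by fun_prop) fun w hw => hout z hz.1 w hw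
  -- With w on the slightly larger contour Γ', integrate R(z)R(w) = (R(z) - R(w))/(w - z) over w.
  -- The first term gives 2πi R(z), since Γ' winds once around z.
  have h1 : ∀ z ∈ Γ, R z * Q = c • R z - G z := by
    intro z hz
    have e1 : R z * Q = boundaryIntegral (fun w => R z * R w)
        (a₁ - ε) (a₂ + ε) (b₁ - ε) (b₂ + ε) := by
      rw [← henl]
      exact (boundaryIntegral_comp (ContinuousLinearMap.mul ℂ (H →L[ℂ] H) (R z))
        ha' hb' hRc').symm
    have e2 : boundaryIntegral (fun w => (w - z)⁻¹ • R z)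
        (a₁ - ε) (a₂ + ε) (b₁ - ε) (b₂ + ε) = c • R z := by
      have h := boundaryIntegral_comp (ContinuousLinearMap.toSpanSingleton ℂ (R z))
        ha' hb' (hcG z hz)
      obtain ⟨⟨k1, k2⟩, k3, k4⟩ := hz.1
      rw [boundaryIntegral_inv_sub (by linarith) (by linarith) (by linarith) (by linarith)] at h
      exact h
    have e3 := boundaryIntegral_sub ha' hb' (f := fun w => (w - z)⁻¹ • R z)
      (g := fun w => (w - z)⁻¹ • R w) ((hcG z hz).smul continuousOn_const) ((hcG z hz).smul hRc')
    rw [e1, ← e2]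
    refine Eq.trans ?_ e3
    refine boundaryIntegral_congr ha' hb' fun w hw => ?_
    have h2 := (isResolventAt_resolventOp (hΓ hz)).sub_eq (isResolventAt_resolventOp (hΓ' hw))
    rw [← smul_sub, hRdef, h2, smul_smul, inv_mul_cancel₀ (hout z hz.1 w hw), one_smul]
  have hFc : ContinuousOn (Function.uncurry fun z w : ℂ => (w - z)⁻¹ • R w) (Γ ×ˢ Γ') := by
    refine ContinuousOn.smul (ContinuousOn.inv₀ (by fun_prop) fun x hx => hout _ hx.1.1 _ hx.2) ?_
    exact hRc'.comp continuousOn_snd fun x hx => hx.2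
  -- After the order of integration is exchanged, 1/(w - z) is holomorphic in z inside Γ because w
  -- lies outside.
  have h2 : boundaryIntegral G a₁ a₂ b₁ b₂ = 0 := by
    rw [hG, boundaryIntegral_swap ha hb ha' hb' hFc]
    have : ∀ w ∈ Γ', boundaryIntegral (fun z => (w - z)⁻¹ • R w) a₁ a₂ b₁ b₂ =
        (fun _ => (0 : H →L[ℂ] H)) w := by
      intro w hw
      refine boundaryIntegral_eq_zero ha hb fun z hz => ?_
      exact (DifferentiableAt.inv (by fun_prop) (hout z hz w hw)).smul_const _
    rw [boundaryIntegral_congr ha' hb' this]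
    simp [boundaryIntegral]
  have hGeq : Set.EqOn (fun z => c • R z - R z * Q) G Γ := fun z hz => by
    simp only
    rw [h1 z hz]; abel
  have h3 : Q * Q = c • Q := by
    have e1 : boundaryIntegral (fun z => R z * Q) a₁ a₂ b₁ b₂ = Q * Q :=
      boundaryIntegral_comp ((ContinuousLinearMap.mul ℂ (H →L[ℂ] H)).flip Q) ha hb hRc
    have e2 : boundaryIntegral (fun z => c • R z) a₁ a₂ b₁ b₂ = c • Q :=
      boundaryIntegral_comp (c • ContinuousLinearMap.id ℂ (H →L[ℂ] H)) ha hb hRc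
    rw [← boundaryIntegral_congr ha hb hGeq, boundaryIntegral_sub ha hb
      (f := fun z => c • R z) (g := fun z => R z * Q) (hRc.const_smul c) (hRc.mul continuousOn_const), e1, e2] at h2
    exact (sub_eq_zero.1 h2).symm
  rw [rieszIntegral_eq, ← hRdef, ← hQ, ← hc, smul_mul_smul_comm, h3, smul_smul]
  congr 1
  field_simp

/-- `Q` is injective on the range of `P`: if Px = x and Qx = 0, then ‖x‖ = ‖(P - Q)x‖, which is less
than ‖x‖ unless x = 0. -/
theorem rangeDim_le_of_norm_sub_lt_one {P Q : H →L[ℂ] H} (hP : P * P = P) (hPQ : ‖P - Q‖ < 1) :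
    rangeDim P ≤ rangeDim Q := by
  have hfix : ∀ x ∈ LinearMap.range (P : H →ₗ[ℂ] H), P x = x := by
    rintro _ ⟨y, rfl⟩
    exact congrArg (fun S : H →L[ℂ] H => S y) hP
  refine LinearMap.rank_le_of_injective
    ((Q : H →ₗ[ℂ] H).rangeRestrict.comp (LinearMap.range (P : H →ₗ[ℂ] H)).subtype) ?_
  rw [← LinearMap.ker_eq_bot, LinearMap.ker_eq_bot']
  rintro ⟨x, hx⟩ h
  have hQ : Q x = 0 := congrArg Subtype.val h
  have h1 : ‖x‖ ≤ ‖P - Q‖ * ‖x‖ := by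
    have := (P - Q).le_opNorm x
    rwa [sub_apply, hQ, hfix x hx, sub_zero] at this
  have h2 : ‖x‖ = 0 := by
    by_contra h0
    have : 0 < ‖x‖ := lt_of_le_of_ne (norm_nonneg _) (Ne.symm h0)
    nlinarith
  exact Subtype.ext (norm_eq_zero.1 h2)

/-- The rank is constant along a Lipschitz path of projections. -/
theorem rangeDim_eq_of_lipschitz_path {S : ℝ → H →L[ℂ] H} {c : ℝ}
    (hS : ∀ s ∈ Set.Icc (0 : ℝ) 1, S s * S s = S s)
    (hc : ∀ s ∈ Set.Icc (0 : ℝ) 1, ∀ s' ∈ Set.Icc (0 : ℝ) 1, ‖S s - S s'‖ ≤ c * |s - s'|) :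
    rangeDim (S 1) = rangeDim (S 0) := by
  -- With n > c equal steps, consecutive projections are less than 1 apart; the maximum with 0
  -- ensures n > 0.
  obtain ⟨n, hn⟩ := exists_nat_gt (max c 0)
  have hn0 : (0 : ℝ) < n := (le_max_right _ _).trans_lt hn
  have hcn : c < n := (le_max_left _ _).trans_lt hn
  have hmem : ∀ k : ℕ, k ≤ n → (k / n : ℝ) ∈ Set.Icc (0 : ℝ) 1 := fun k hk =>
    ⟨by positivity, by rw [div_le_one hn0]; exact_mod_cast hk⟩
  have key : ∀ k : ℕ, k ≤ n → rangeDim (S (k / n)) = rangeDim (S 0) := by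
    intro k
    induction k with
    | zero => intro _; simp
    | succ k ih =>
      intro hk
      rw [← ih (by omega)]
      have h1 := hmem (k + 1) hk
      have h2 := hmem k (by omega)
      have h3 : |((k + 1 : ℕ) / n : ℝ) - k / n| = 1 / n := by
        rw [← sub_div]
        push_cast
        rw [add_sub_cancel_left, abs_of_pos (by positivity)]
      have h4 : ‖S ((k + 1 : ℕ) / n) - S (k / n)‖ < 1 := by
        refine (hc _ h1 _ h2).trans_lt ?_
        rw [h3, mul_one_div, div_lt_one hn0]
        exact hcn
      refine le_antisymm (rangeDim_le_of_norm_sub_lt_one (hS _ h1) h4)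
        (rangeDim_le_of_norm_sub_lt_one (hS _ h2) ?_)
      rwa [norm_sub_rev]
  have := key n le_rfl
  rwa [div_self hn0.ne'] at this

variable {T B : H →ₗ.[ℂ] H}

/-- The sum lives on the intersection of the domains, which is dom T. This identifies the start of
the path T + sB. -/
theorem add_zero_smul_eq (hdom : T.domain ≤ B.domain) : T + (0 : ℂ) • B = T := by
  refine LinearPMap.ext (inf_eq_left.2 hdom) fun x hx hx' => ?_
  rw [LinearPMap.add_apply, LinearPMap.smul_apply, zero_smul, add_zero]

variable [CompleteSpace H]

/-- From z - T - sB = (1 - sC)(z - T) with C = BR; the bound 2 is uniform over |s| ≤ 1. -/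
theorem IsResolventAt.perturb {z : ℂ} {R C : H →L[ℂ] H}
    (hR : IsResolventAt T z R) (hC : ∀ f, ∃ hf : R f ∈ B.domain, B ⟨R f, hf⟩ = C f)
    (hCn : ‖C‖ ≤ 1 / 2) {s : ℂ} (hs : ‖s‖ ≤ 1) :
    ∃ U : (H →L[ℂ] H)ˣ, (U : H →L[ℂ] H) = 1 - s • C ∧ ‖(↑U⁻¹ : H →L[ℂ] H)‖ ≤ 2 ∧
      IsResolventAt (T + s • B) z (R * (↑U⁻¹ : H →L[ℂ] H)) := by
  have hsC : ‖s • C‖ ≤ 1 / 2 := by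
    rw [norm_smul]
    nlinarith [norm_nonneg C]
  obtain ⟨U, hU, hUn⟩ := exists_units_one_sub hsC
  refine ⟨U, hU, hUn, hR.mul_inv inf_le_left U fun f => ?_⟩
  obtain ⟨hf, e⟩ := hR.1 f
  obtain ⟨hf', e'⟩ := hC f
  refine ⟨⟨hf, hf'⟩, ?_⟩
  rw [LinearPMap.add_apply, LinearPMap.smul_apply, hU]
  have h1 : (1 - s • C) f = f - s • C f := rfl
  rw [h1, ← e']
  exact (sub_add_eq_sub_sub _ _ _).trans (congrArg (· - s • B ⟨R f, hf'⟩) e)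

/-- If `‖B (z - T)⁻¹‖ ≤ 1/2` on the boundary of a rectangle, then the Riesz projections of `T + B`
and of `T` have the same rank. -/
theorem rangeDim_rieszIntegral_add (hdom : T.domain ≤ B.domain) {a₁ a₂ b₁ b₂ r : ℝ}
    (ha : a₁ ≤ a₂) (hb : b₁ ≤ b₂)
    (hΓ : ∀ z ∈ rectSides a₁ a₂ b₁ b₂, ∃ R C : H →L[ℂ] H, IsResolventAt T z R ∧ ‖R‖ ≤ r ∧
      (∀ f, ∃ hf : R f ∈ B.domain, B ⟨R f, hf⟩ = C f) ∧ ‖C‖ ≤ 1 / 2) :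
    rangeDim (rieszIntegral (T + B) a₁ a₂ b₁ b₂) = rangeDim (rieszIntegral T a₁ a₂ b₁ b₂) := by
  have hnorm : ∀ s ∈ Set.Icc (0 : ℝ) 1, ‖(s : ℂ)‖ ≤ 1 := fun s hs => by
    rw [Complex.norm_real, Real.norm_eq_abs, abs_of_nonneg hs.1]
    exact hs.2
  have hsub : ∀ s ∈ Set.Icc (0 : ℝ) 1,
      rectSides a₁ a₂ b₁ b₂ ⊆ resolventSet (T + (s : ℂ) • B) := by
    intro s hs z hz
    obtain ⟨R, C, hR, -, hC, hCn⟩ := hΓ z hz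
    obtain ⟨U, -, -, hU⟩ := hR.perturb hC hCn (hnorm s hs)
    exact hU.mem
  have hlip : ∀ s ∈ Set.Icc (0 : ℝ) 1, ∀ s' ∈ Set.Icc (0 : ℝ) 1, ∀ z ∈ rectSides a₁ a₂ b₁ b₂,
      ‖resolventOp (T + (s : ℂ) • B) z - resolventOp (T + (s' : ℂ) • B) z‖ ≤
        2 * r * |s - s'| := by
    intro s hs s' hs' z hz
    obtain ⟨R, C, hR, hRn, hC, hCn⟩ := hΓ z hz
    obtain ⟨U, hU, hUn, hUR⟩ := hR.perturb hC hCn (hnorm s hs)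
    obtain ⟨V, hV, hVn, hVR⟩ := hR.perturb hC hCn (hnorm s' hs')
    rw [hUR.resolventOp_eq, hVR.resolventOp_eq]
    -- The identity U⁻¹ - V⁻¹ = U⁻¹(V - U)V⁻¹ with V - U = (s - s')C gives the Lipschitz constant r
    -- · 2 · (1/2) · 2 = 2r.
    have e : R * (↑U⁻¹ : H →L[ℂ] H) - R * (↑V⁻¹ : H →L[ℂ] H) =
        ((s : ℂ) - s') • (R * ((↑U⁻¹ : H →L[ℂ] H) * (C * (↑V⁻¹ : H →L[ℂ] H)))) := by
      have h1 : (↑U⁻¹ : H →L[ℂ] H) - (↑V⁻¹ : H →L[ℂ] H) =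
          (↑U⁻¹ : H →L[ℂ] H) * ((V : H →L[ℂ] H) - U) * (↑V⁻¹ : H →L[ℂ] H) := by
        rw [mul_sub, sub_mul, Units.inv_mul, mul_assoc, Units.mul_inv, mul_one, one_mul]
      have h2 : (V : H →L[ℂ] H) - U = ((s : ℂ) - s') • C := by
        rw [hU, hV, sub_smul]; abel
      rw [← mul_sub, h1, h2, mul_smul_comm, smul_mul_assoc, mul_smul_comm, mul_assoc]
    have hr : 0 ≤ r := (norm_nonneg R).trans hRn
    rw [e, norm_smul, ← Complex.ofReal_sub, Complex.norm_real, Real.norm_eq_abs]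
    have h3 : ‖R * ((↑U⁻¹ : H →L[ℂ] H) * (C * (↑V⁻¹ : H →L[ℂ] H)))‖ ≤ r * (2 * (1 / 2 * 2)) := by
      refine (norm_mul_le _ _).trans (mul_le_mul hRn ?_ (norm_nonneg _) hr)
      refine (norm_mul_le _ _).trans (mul_le_mul hUn ?_ (norm_nonneg _) zero_le_two)
      exact (norm_mul_le _ _).trans (mul_le_mul hCn hVn (norm_nonneg _) (by norm_num))
    nlinarith [abs_nonneg (s - s')]
  have h := rangeDim_eq_of_lipschitz_path
    (S := fun s : ℝ => rieszIntegral (T + (s : ℂ) • B) a₁ a₂ b₁ b₂)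
    (c := ‖1 / (2 * (Real.pi : ℂ) * Complex.I)‖ *
      (2 * r * (2 * (a₂ - a₁) + 2 * (b₂ - b₁))))
    (fun s hs => rieszIntegral_mul_self _ ha hb (hsub s hs)) ?_
  · simpa only [Complex.ofReal_one, one_smul, Complex.ofReal_zero, add_zero_smul_eq hdom] using h
  · intro s hs s' hs'
    rw [rieszIntegral_eq, rieszIntegral_eq, ← smul_sub, norm_smul, mul_assoc,
      ← boundaryIntegral_sub ha hb (continuousOn_resolventOp (hsub s hs))
        (continuousOn_resolventOp (hsub s' hs'))]
    exact (mul_le_mul_of_nonneg_left (norm_boundaryIntegral_le ha hb (hlip s hs s' hs'))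
      (norm_nonneg _)).trans (le_of_eq (by ring))

end RieszProjections

/-! ### Operators with an orthonormal basis of eigenvectors -/

section DiagonalOperators

variable {H : Type*} [NormedAddCommGroup H] [InnerProductSpace ℂ H] {ι : Type*}

/-- A closed operator may be applied to a convergent series term by term. -/
theorem exists_apply_eq_of_hasSum {A : H →ₗ.[ℂ] H} (hA : A.IsClosed) (v : ι → A.domain) {x y : H}
    (hx : HasSum (fun i => (v i : H)) x) (hy : HasSum (fun i => A (v i)) y) :
    ∃ h : x ∈ A.domain, A ⟨x, h⟩ = y := by
  have hmem : (x, y) ∈ A.graph := by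
    refine (show _root_.IsClosed (A.graph : Set (H × H)) from hA).mem_of_tendsto
      (hx.prodMk_nhds hy) (Eventually.of_forall fun s => ?_)
    have h := Submodule.sum_mem A.graph fun i (_ : i ∈ s) => A.mem_graph (v i)
    convert h using 1
    simp [Prod.fst_sum, Prod.snd_sum]
  obtain ⟨u, hu, hu'⟩ := A.mem_graph_iff.1 hmem
  simp only at hu hu'
  subst hu
  exact ⟨u.2, hu'⟩

/-- The operator which is diagonal in a Hilbert basis with given bounded eigenvalues. -/
theorem exists_diagonal (φ : HilbertBasis ι ℂ H) {m : ι → ℂ} {c : ℝ} (hc : 0 ≤ c)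
    (hm : ∀ i, ‖m i‖ ≤ c) :
    ∃ D : H →L[ℂ] H, ‖D‖ ≤ c ∧ ∀ f, HasSum (fun i => (m i * φ.repr f i) • φ i) (D f) := by
  have hle : ∀ f i, ‖m i * φ.repr f i‖ ≤ ‖((c : ℂ) • φ.repr f) i‖ := fun f i => by
    rw [lp.coeFn_smul, Pi.smul_apply, norm_mul, norm_smul, Complex.norm_real, Real.norm_eq_abs,
      abs_of_nonneg hc]
    exact mul_le_mul_of_nonneg_right (hm i) (norm_nonneg _)
  have hmem : ∀ f, Memℓp (fun i => m i * φ.repr f i) 2 := fun f =>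
    (lp.memℓp ((c : ℂ) • φ.repr f)).mono' (hle f)
  let D₀ : H →ₗ[ℂ] H :=
    { toFun := fun f => φ.repr.symm ⟨fun i => m i * φ.repr f i, hmem f⟩
      map_add' := fun f g => by
        rw [← map_add]
        congr 1
        ext i
        simp only [map_add, lp.coeFn_add, Pi.add_apply, mul_add]
      map_smul' := fun a f => by
        rw [RingHom.id_apply, ← map_smul]
        congr 1
        ext i
        simp only [map_smul, lp.coeFn_smul, Pi.smul_apply, smul_eq_mul]
        ring }
  have hD : ∀ f, ‖D₀ f‖ ≤ c * ‖f‖ := fun f => by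
    have h1 : ‖(⟨fun i => m i * φ.repr f i, hmem f⟩ : lp (fun _ : ι => ℂ) 2)‖ ≤
        ‖(c : ℂ) • φ.repr f‖ := lp.norm_mono two_ne_zero (hle f)
    rw [norm_smul, Complex.norm_real, Real.norm_eq_abs, abs_of_nonneg hc,
      LinearIsometryEquiv.norm_map] at h1
    exact (LinearIsometryEquiv.norm_map φ.repr.symm _).trans_le h1
  exact ⟨D₀.mkContinuous c hD, LinearMap.mkContinuous_norm_le _ hc _,
    fun f => φ.hasSum_repr_symm ⟨fun i => m i * φ.repr f i, hmem f⟩⟩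

/-- The operator with given square summable images of the vectors of a Hilbert basis. -/
theorem exists_operator_of_sum_sq_le [CompleteSpace H] (φ : HilbertBasis ι ℂ H) {v : ι → H} {c : ℝ}
    (hc : 0 ≤ c) (hv : ∀ s : Finset ι, ∑ i ∈ s, ‖v i‖ ^ 2 ≤ c ^ 2) :
    ∃ C : H →L[ℂ] H, ‖C‖ ≤ c ∧ ∀ f, HasSum (fun i => φ.repr f i • v i) (C f) := by
  -- Cauchy–Schwarz together with Bessel's inequality: the operator norm is bounded by the
  -- Hilbert–Schmidt norm.
  have hfin : ∀ f (s : Finset ι), ∑ i ∈ s, ‖φ.repr f i • v i‖ ≤ c * ‖f‖ := fun f s => by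
    have h1 : ∑ i ∈ s, ‖φ.repr f i‖ ^ 2 ≤ ‖f‖ ^ 2 := by
      simp_rw [φ.repr_apply_apply]
      exact φ.orthonormal.sum_inner_products_le f
    simp_rw [norm_smul]
    refine abs_le_of_sq_le_sq' ?_ (by positivity) |>.2
    refine (Finset.sum_mul_sq_le_sq_mul_sq s _ _).trans ?_
    rw [mul_pow, mul_comm]
    exact mul_le_mul (hv s) h1 (Finset.sum_nonneg fun _ _ => by positivity) (by positivity)
  have hsum : ∀ f, Summable fun i => ‖φ.repr f i • v i‖ := fun f =>
    summable_of_sum_le (fun i => norm_nonneg _) (hfin f)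
  have hs : ∀ f, HasSum (fun i => φ.repr f i • v i) (∑' i, φ.repr f i • v i) := fun f =>
    (hsum f).of_norm.hasSum
  let C₀ : H →ₗ[ℂ] H :=
    { toFun := fun f => ∑' i, φ.repr f i • v i
      map_add' := fun f g => by
        refine (hs (f + g)).unique ?_
        simpa [add_smul] using (hs f).add (hs g)
      map_smul' := fun a f => by
        refine (hs (a • f)).unique ?_
        simpa [mul_smul] using (hs f).const_smul a }
  have hC : ∀ f, ‖C₀ f‖ ≤ c * ‖f‖ := fun f =>
    (tsum_of_norm_bounded (hsum f).hasSum fun _ => le_rfl).trans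
      ((hsum f).tsum_le_of_sum_le (hfin f))
  exact ⟨C₀.mkContinuous c hC, LinearMap.mkContinuous_norm_le _ hc _, hs⟩

theorem rangeDim_eq_card (φ : HilbertBasis ι ℂ H) {S : H →L[ℂ] H} (F : Finset ι)
    (h₁ : ∀ k ∈ F, S (φ k) = φ k) (h₀ : ∀ k ∉ F, S (φ k) = 0) : rangeDim S = (F.card : Cardinal) := by
  have hS : ∀ f, S f = ∑ k ∈ F, φ.repr f k • φ k := fun f => by
    have h1 := (φ.hasSum_repr f).mapL S
    simp only [map_smul] at h1
    have h2 : HasSum (fun k => φ.repr f k • S (φ k)) (∑ k ∈ F, φ.repr f k • S (φ k)) :=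
      hasSum_sum_of_ne_finset_zero fun k hk => by rw [h₀ k hk, smul_zero]
    rw [h1.unique h2]
    exact Finset.sum_congr rfl fun k hk => by rw [h₁ k hk]
  have hrange : LinearMap.range (S : H →ₗ[ℂ] H) =
      Submodule.span ℂ (Set.range fun k : F => φ k) := by
    refine le_antisymm ?_ (Submodule.span_le.2 ?_)
    · rintro _ ⟨f, rfl⟩
      have : (S : H →ₗ[ℂ] H) f = ∑ k ∈ F, φ.repr f k • φ k := hS f
      rw [this]
      exact Submodule.sum_mem _ fun k hk =>
        Submodule.smul_mem _ _ (Submodule.subset_span ⟨⟨k, hk⟩, rfl⟩)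
    · rintro _ ⟨k, rfl⟩
      exact ⟨φ k, h₁ k k.2⟩
  have hli : LinearIndependent ℂ fun k : F => φ k :=
    φ.orthonormal.linearIndependent.comp _ Subtype.val_injective
  have : Module.Finite ℂ (Submodule.span ℂ (Set.range fun k : F => φ k)) :=
    FiniteDimensional.span_of_finite ℂ (Set.finite_range _)
  rw [rangeDim, hrange, ← Module.finrank_eq_rank, finrank_span_eq_card hli, Fintype.card_coe]

variable [CompleteSpace H] {T : H →ₗ.[ℂ] H} {φ : HilbertBasis ι ℂ H} {hφ : ∀ k, φ k ∈ T.domain}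
  {τ : ι → ℝ}

/-- Symmetry moves `T` onto φ_k. This makes the diagonal operator a left inverse of z - T on all of
dom T, not only on the span of the eigenvectors. -/
theorem repr_apply_of_isSelfAdjoint (hT : IsSelfAdjoint T)
    (hTφ : ∀ k, T ⟨φ k, hφ k⟩ = (τ k : ℂ) • φ k) (x : T.domain) (k : ι) :
    φ.repr (T x) k = τ k * φ.repr (x : H) k := by
  have h : T.IsFormalAdjoint T := by
    have h1 := LinearPMap.adjoint_isFormalAdjoint hT.dense_domain
    rwa [LinearPMap.isSelfAdjoint_def.1 hT] at h1
  rw [φ.repr_apply_apply, φ.repr_apply_apply, ← h ⟨φ k, hφ k⟩ x, hTφ, inner_smul_left,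
    Complex.conj_ofReal]

/-- The resolvent of a selfadjoint operator with a Hilbert basis of eigenvectors. -/
theorem exists_isResolventAt_diagonal (hT : IsSelfAdjoint T)
    (hTφ : ∀ k, T ⟨φ k, hφ k⟩ = (τ k : ℂ) • φ k) {z : ℂ} {r : ℝ} (hr : 0 < r)
    (hz : ∀ k, r ≤ ‖z - τ k‖) :
    ∃ R : H →L[ℂ] H, IsResolventAt T z R ∧ ‖R‖ ≤ 1 / r ∧
      ∀ f, HasSum (fun k => ((z - τ k)⁻¹ * φ.repr f k) • φ k) (R f) := by
  have hne : ∀ k, z - τ k ≠ 0 := fun k h => by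
    have := hz k
    rw [h, norm_zero] at this
    linarith
  obtain ⟨R, hRn, hR⟩ := exists_diagonal φ (m := fun k => (z - τ k)⁻¹) (c := 1 / r)
    (by positivity) fun k => by
      rw [norm_inv, ← one_div]
      exact one_div_le_one_div_of_le hr (hz k)
  refine ⟨R, ⟨fun f => ?_, fun x => ?_⟩, hRn, hR⟩
  -- Termwise τ_k/(z - τ_k) = z/(z - τ_k) - 1, so the image series converges to zRf - f and
  -- closedness of `T` puts Rf in its domain.
  · have h1 : HasSum (fun k => T (((z - τ k)⁻¹ * φ.repr f k) • (⟨φ k, hφ k⟩ : T.domain)))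
        (z • R f - f) := by
      refine (((hR f).const_smul z).sub (φ.hasSum_repr f)).congr_fun fun k => ?_
      rw [LinearPMap.map_smul, hTφ, smul_smul, smul_smul, ← sub_smul]
      congr 1
      field_simp [hne k]
      ring
    obtain ⟨h2, h3⟩ := exists_apply_eq_of_hasSum hT.isClosed
      (fun k => ((z - τ k)⁻¹ * φ.repr f k) • (⟨φ k, hφ k⟩ : T.domain)) (hR f) h1
    exact ⟨h2, by rw [h3]; abel⟩
  · refine (hR _).unique ?_
    refine (φ.hasSum_repr (x : H)).congr_fun fun k => ?_
    congr 1
    rw [map_sub, map_smul, lp.coeFn_sub, Pi.sub_apply, lp.coeFn_smul, Pi.smul_apply,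
      repr_apply_of_isSelfAdjoint hT hTφ, smul_eq_mul, ← sub_mul, inv_mul_cancel_left₀ (hne k)]

/-- The operator `B (z - T)⁻¹` for a closed operator `B` defined on the domain of `T`. -/
theorem exists_isResolventAt_and_comp (hT : IsSelfAdjoint T)
    (hTφ : ∀ k, T ⟨φ k, hφ k⟩ = (τ k : ℂ) • φ k) {B : H →ₗ.[ℂ] H} (hB : B.IsClosed)
    (hdom : T.domain ≤ B.domain) {z : ℂ} {r : ℝ} (hr : 0 < r) (hz : ∀ k, r ≤ ‖z - τ k‖)
    (hsum : ∀ s : Finset ι,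
      ∑ k ∈ s, ‖B ⟨φ k, hdom (hφ k)⟩‖ ^ 2 / ‖z - τ k‖ ^ 2 ≤ 1 / 4) :
    ∃ R C : H →L[ℂ] H, IsResolventAt T z R ∧ ‖R‖ ≤ 1 / r ∧
      (∀ f, ∃ hf : R f ∈ B.domain, B ⟨R f, hf⟩ = C f) ∧ ‖C‖ ≤ 1 / 2 := by
  obtain ⟨R, hR, hRn, hRs⟩ := exists_isResolventAt_diagonal hT hTφ hr hz
  -- The images B(z - T)⁻¹φ_k define `C`; `hsum` bounds its squared Hilbert–Schmidt norm by 1/4.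
  -- Closedness of `B` then yields BR = C everywhere.
  obtain ⟨C, hCn, hC⟩ := exists_operator_of_sum_sq_le φ
    (v := fun k => (z - τ k)⁻¹ • B ⟨φ k, hdom (hφ k)⟩) (c := 1 / 2) (by norm_num) fun s => by
      refine le_trans (le_of_eq (Finset.sum_congr rfl fun k _ => ?_)) ((hsum s).trans (by norm_num))
      rw [norm_smul, norm_inv, mul_pow, inv_pow, div_eq_inv_mul]
  refine ⟨R, C, hR, hRn, fun f => ?_, hCn⟩
  refine exists_apply_eq_of_hasSum hB
    (fun k => ((z - τ k)⁻¹ * φ.repr f k) • (⟨φ k, hdom (hφ k)⟩ : B.domain)) (hRs f) ?_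
  refine (hC f).congr_fun fun k => ?_
  rw [LinearPMap.map_smul, smul_smul, mul_comm]

/-- The rank of the Riesz projection of a diagonal operator is the number of eigenvalues in the
rectangle. -/
theorem rangeDim_rieszIntegral_diagonal
    (hTφ : ∀ k, T ⟨φ k, hφ k⟩ = (τ k : ℂ) • φ k) {a₁ a₂ b₁ b₂ : ℝ} (ha : a₁ ≤ a₂)
    (hb₁ : b₁ < 0) (hb₂ : 0 < b₂) (hΓ : rectSides a₁ a₂ b₁ b₂ ⊆ resolventSet T) (F : Finset ι)
    (hF : ∀ k ∈ F, a₁ < τ k ∧ τ k < a₂) (hF' : ∀ k ∉ F, τ k < a₁ ∨ a₂ < τ k) :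
    rangeDim (rieszIntegral T a₁ a₂ b₁ b₂) = (F.card : Cardinal) := by
  have hb : b₁ ≤ b₂ := by linarith
  have hne : ∀ k, ∀ z ∈ rectSides a₁ a₂ b₁ b₂, z - τ k ≠ 0 := by
    rintro k z ⟨⟨⟨h1, h2⟩, h3, h4⟩, h5⟩ h0
    rw [sub_eq_zero] at h0
    subst h0
    simp only [Complex.ofReal_re, Complex.ofReal_im] at h1 h2 h3 h4 h5
    by_cases hk : k ∈ F
    · have := hF k hk
      rcases h5 with h | h | h | h <;> linarith
    · rcases hF' k hk with h | h <;> linarith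
  -- Every resolvent multiplies φ_k by 1/(z - τ_k), so the Riesz integral multiplies it by the
  -- winding number around τ_k.
  have hval : ∀ k, rieszIntegral T a₁ a₂ b₁ b₂ (φ k) = (1 / (2 * (Real.pi : ℂ) * Complex.I)) •
      boundaryIntegral (fun z => (z - τ k)⁻¹) a₁ a₂ b₁ b₂ • φ k := by
    intro k
    have e1 := boundaryIntegral_comp (ContinuousLinearMap.apply ℂ H (φ k)) ha hb
      (continuousOn_resolventOp hΓ)
    have e2 := boundaryIntegral_comp (ContinuousLinearMap.toSpanSingleton ℂ (φ k)) ha hb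
      (f := fun z => (z - τ k)⁻¹) (ContinuousOn.inv₀ (by fun_prop) (hne k))
    rw [rieszIntegral_eq, smul_apply]
    congr 1
    refine e1.symm.trans (Eq.trans ?_ e2)
    refine boundaryIntegral_congr ha hb fun z hz => ?_
    have h1 : (z - τ k) • resolventOp T z (φ k) = φ k := by
      have h2 := (isResolventAt_resolventOp (hΓ hz)).2 ⟨φ k, hφ k⟩
      rwa [hTφ, ← sub_smul, map_smul] at h2
    simp only [ContinuousLinearMap.apply_apply, ContinuousLinearMap.toSpanSingleton_apply]
    rw [eq_inv_smul_iff₀ (hne k z hz), h1]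
  refine rangeDim_eq_card φ F (fun k hk => ?_) fun k hk => ?_
  · have := hF k hk
    rw [hval, boundaryIntegral_inv_sub (by simpa using this.1) (by simpa using this.2)
      (by simpa using hb₁) (by simpa using hb₂), smul_smul, one_div,
      inv_mul_cancel₀ two_pi_I_ne_zero, one_smul]
  · rw [hval, boundaryIntegral_eq_zero ha hb, zero_smul, smul_zero]
    intro z hz
    refine DifferentiableAt.inv (by fun_prop) fun h0 => ?_
    rw [sub_eq_zero] at h0
    subst h0
    obtain ⟨⟨h1, h2⟩, -⟩ := hz
    simp only [Complex.ofReal_re] at h1 h2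
    rcases hF' k hk with h | h <;> linarith

end DiagonalOperators

/-! ### Clusters of eigenvalues and estimates of ∑ β_k / |z - τ_k|² -/

section Clusters

/-- The indices `1, 2, ...` are divided into the clusters `(e c, e (c + 1)]` of at most `p`
elements, and `τ` jumps by at least `2δ` from the end of each cluster to the next one. -/
structure IsClustering (τ : ℕ → ℝ) (e : ℕ → ℕ) (p : ℕ) (δ : ℝ) : Prop where
  strictMono : StrictMono τ
  zero : e 0 = 0
  lt_succ : ∀ c, e c < e (c + 1)
  succ_le : ∀ c, e (c + 1) ≤ e c + p
  pos : 0 < δ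
  gap : ∀ c, 2 * δ ≤ τ (e c + 1) - τ (e c)

/-- The wall on the left of cluster `c`. -/
def wall (τ : ℕ → ℝ) (e : ℕ → ℕ) (δ : ℝ) (c : ℕ) : ℝ := τ (e c) + δ

theorem sum_le_mul_tsum_of_card_fiber_le {ι : Type*} (s : Finset ι) (u : ι → ℕ) {q : ℕ}
    (hq : ∀ n, (s.filter fun k => u k = n).card ≤ q) {g : ℕ → ℝ} (hg : ∀ n, 0 ≤ g n)
    (hs : Summable g) : ∑ k ∈ s, g (u k) ≤ q * ∑' n, g n := by
  rw [Finset.sum_comp]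
  calc ∑ b ∈ s.image u, (s.filter fun k => u k = b).card • g b
      ≤ ∑ b ∈ s.image u, q * g b := Finset.sum_le_sum fun b _ => by
        rw [nsmul_eq_mul]
        exact mul_le_mul_of_nonneg_right (by exact_mod_cast hq b) (hg b)
    _ = q * ∑ b ∈ s.image u, g b := by rw [Finset.mul_sum]
    _ ≤ q * ∑' n, g n :=
        mul_le_mul_of_nonneg_left (hs.sum_le_tsum _ fun n _ => hg n) (by positivity)

namespace IsClustering

variable {τ : ℕ → ℝ} {e : ℕ → ℕ} {p : ℕ} {δ : ℝ} (hc : IsClustering τ e p δ)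

include hc

theorem e_strictMono : StrictMono e := strictMono_nat_of_lt_succ hc.lt_succ

theorem le_e (c : ℕ) : c ≤ e c := hc.e_strictMono.le_apply

/-- The jump of at least 2δ after τ (e c) separates the ends of consecutive clusters. -/
theorem wall_add_le (c n : ℕ) : wall τ e δ c + 2 * δ * n ≤ wall τ e δ (c + n) := by
  induction n with
  | zero => simp
  | succ n ih =>
    have h1 := hc.gap (c + n)
    have h2 := hc.strictMono.monotone (hc.lt_succ (c + n) : e (c + n) + 1 ≤ e (c + n + 1))
    rw [← add_assoc]
    unfold wall at ih ⊢
    push_cast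
    linarith

theorem wall_mono : Monotone (wall τ e δ) := by
  intro c c' h
  obtain ⟨n, rfl⟩ := Nat.exists_eq_add_of_le h
  have := hc.wall_add_le c n
  have h2 : 0 ≤ 2 * δ * n := by have := hc.pos; positivity
  linarith

theorem wall_add_le_of_lt {c k : ℕ} (hk : e c < k) : wall τ e δ c + δ ≤ τ k := by
  have h1 := hc.gap c
  have h2 := hc.strictMono.monotone (show e c + 1 ≤ k from hk)
  unfold wall
  linarith

theorem le_wall_sub_of_le {c k : ℕ} (hk : k ≤ e c) : τ k ≤ wall τ e δ c - δ := by
  have h2 := hc.strictMono.monotone hk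
  unfold wall
  linarith

theorem exists_cluster (k : ℕ+) : ∃ c, e c < k ∧ (k : ℕ) ≤ e (c + 1) := by
  classical
  have hex : ∃ c, (k : ℕ) ≤ e (c + 1) := ⟨k, (Nat.le_succ _).trans (hc.le_e _)⟩
  refine ⟨Nat.find hex, ?_, Nat.find_spec hex⟩
  rcases h : Nat.find hex with _ | c
  · rw [hc.zero]; exact k.pos
  · by_contra! hk
    exact Nat.find_min hex (m := c) (by omega) hk

/-- Every real number to the right of the first wall is between two walls. -/
theorem exists_wall {a : ℝ} (ha : wall τ e δ 0 ≤ a) :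
    ∃ c, wall τ e δ c ≤ a ∧ a ≤ wall τ e δ (c + 1) := by
  classical
  have hex : ∃ c, a < wall τ e δ (c + 1) := by
    obtain ⟨n, hn⟩ := exists_nat_gt ((a - wall τ e δ 0) / (2 * δ))
    have hδ := hc.pos
    rw [div_lt_iff₀ (by positivity)] at hn
    have h1 := hc.wall_add_le 0 n
    have h2 := hc.wall_mono (show 0 + n ≤ n + 1 by omega)
    exact ⟨n, by linarith⟩
  refine ⟨Nat.find hex, ?_, (Nat.find_spec hex).le⟩
  rcases h : Nat.find hex with _ | c
  · exact ha
  · by_contra! hk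
    exact Nat.find_min hex (m := c) (by omega) hk

/-- The distance from a point between two walls to the elements of another cluster. -/
theorem mul_dist_le {a : ℝ} {c i k : ℕ} (ha₁ : c = 0 ∨ wall τ e δ c ≤ a)
    (ha₂ : a ≤ wall τ e δ (c + 1)) (hk₁ : e i < k) (hk₂ : k ≤ e (i + 1)) :
    δ * ((i - c) + (c - i) : ℕ) ≤ |a - τ k| := by
  have hδ := hc.pos
  have h1 := hc.wall_add_le_of_lt hk₁
  have h2 := hc.le_wall_sub_of_le hk₂
  -- The truncated differences add up to |i - c|. For |i - c| = n + 1, the n wall spacings of 2δ and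
  -- the margin δ exceed δ(n + 1). A cluster to the left exists only for c ≠ 0, so the left wall is
  -- then available.
  rcases lt_trichotomy i c with h | h | h
  · obtain ⟨n, rfl⟩ := Nat.exists_eq_add_of_lt h
    have h3 := hc.wall_add_le (i + 1) n
    rw [show i + 1 + n = i + n + 1 by ring] at h3
    have h4 : (i - (i + n + 1)) + (i + n + 1 - i) = n + 1 := by omega
    have ha := ha₁.resolve_left (by omega)
    have hn : 0 ≤ δ * n := by positivity
    rw [h4]
    refine le_trans ?_ (le_abs_self _)
    push_cast
    linarith
  · subst h
    simp
  · obtain ⟨n, rfl⟩ := Nat.exists_eq_add_of_lt h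
    have h3 := hc.wall_add_le (c + 1) n
    rw [show c + 1 + n = c + n + 1 by ring] at h3
    have h4 : (c + n + 1 - c) + (c - (c + n + 1)) = n + 1 := by omega
    have hn : 0 ≤ δ * n := by positivity
    rw [h4]
    refine le_trans ?_ (neg_abs_le _ |> neg_le.1)
    push_cast
    linarith

theorem le_dist_wall (c k : ℕ) : δ ≤ |wall τ e δ c - τ k| := by
  rcases le_or_gt k (e c) with h | h
  · have := hc.le_wall_sub_of_le h
    exact le_trans (by linarith) (le_abs_self _)
  · have := hc.wall_add_le_of_lt h
    exact le_trans (by linarith) (neg_abs_le _ |> neg_le.1)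

variable {cl : ℕ+ → ℕ} (hcl : ∀ k : ℕ+, e (cl k) < k ∧ (k : ℕ) ≤ e (cl k + 1))

include hcl

theorem card_filter_cluster_le (s : Finset ℕ+) (c : ℕ) :
    (s.filter fun k => cl k = c).card ≤ p := by
  have h1 : (s.filter fun k => cl k = c).card ≤ (Finset.Ioc (e c) (e (c + 1))).card := by
    refine Finset.card_le_card_of_injOn (fun k : ℕ+ => (k : ℕ)) (fun k hk => ?_)
      (fun _ _ _ _ h => PNat.coe_injective h)
    obtain rfl := (Finset.mem_filter.1 hk).2
    exact Finset.mem_coe.2 (Finset.mem_Ioc.2 (hcl k))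
  rw [Nat.card_Ioc] at h1
  have := hc.succ_le c
  omega

/-- A sum over the indices is bounded by a two-sided sum over the clusters. -/
theorem sum_dist_le (s : Finset ℕ+) (c : ℕ) {g : ℕ → ℝ} (hg : ∀ n, 0 ≤ g n) (hs : Summable g) :
    ∑ k ∈ s, g ((cl k - c) + (c - cl k)) ≤ p * (2 * ∑' n, g n - g 0) := by
  have h1 : ∑ k ∈ s.filter (fun k => c ≤ cl k), g ((cl k - c) + (c - cl k)) ≤
      p * ∑' n, g n := by
    refine sum_le_mul_tsum_of_card_fiber_le _ _ (fun n => ?_) hg hs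
    refine le_trans (Finset.card_le_card fun k hk => ?_)
      (hc.card_filter_cluster_le hcl s (c + n))
    simp only [Finset.mem_filter] at hk ⊢
    obtain ⟨⟨hks, hk1⟩, hk2⟩ := hk
    exact ⟨hks, by omega⟩
  -- Clusters strictly to the left have distance at least 1, hence the shifted series; this is why g
  -- 0 is counted once.
  have h2 : ∑ k ∈ s.filter (fun k => ¬ c ≤ cl k), g ((cl k - c) + (c - cl k)) ≤
      p * ∑' n, g (n + 1) := by
    have h3 : ∑ k ∈ s.filter (fun k => ¬ c ≤ cl k), g ((cl k - c) + (c - cl k)) =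
        ∑ k ∈ s.filter (fun k => ¬ c ≤ cl k), (fun n => g (n + 1)) (c - cl k - 1) := by
      refine Finset.sum_congr rfl fun k hk => ?_
      have := (Finset.mem_filter.1 hk).2
      simp only
      congr 1
      omega
    rw [h3]
    refine sum_le_mul_tsum_of_card_fiber_le _ (fun k => c - cl k - 1) (g := fun n => g (n + 1))
      (fun n => ?_) (fun n => hg _) ((summable_nat_add_iff 1).2 hs)
    refine le_trans (Finset.card_le_card fun k hk => ?_)
      (hc.card_filter_cluster_le hcl s (c - 1 - n))
    simp only [Finset.mem_filter] at hk ⊢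
    obtain ⟨⟨hks, hk1⟩, hk2⟩ := hk
    exact ⟨hks, by omega⟩
  rw [← Finset.sum_filter_add_sum_filter_not s fun k => c ≤ cl k]
  rw [hs.tsum_eq_zero_add] at h1 ⊢
  linarith

/-- The two-sided sum over clusters of at most p points costs 2p, and the target 1/4 turns this into
8p. -/
theorem sum_div_sq_le_of_height {β : ℕ+ → ℝ} {S h : ℝ} {z : ℂ} {c : ℕ} (hβ : ∀ k, 0 ≤ β k)
    (hS : ∀ k, β k ≤ S) (hh : 0 < h)
    (hsum : 8 * p * S * ∑' j : ℕ, 1 / (h ^ 2 + (j * δ) ^ 2) ≤ 1)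
    (hz : ∀ k : ℕ+, h ^ 2 + (δ * ((cl k - c) + (c - cl k) : ℕ)) ^ 2 ≤ ‖z - τ k‖ ^ 2)
    (s : Finset ℕ+) : ∑ k ∈ s, β k / ‖z - τ k‖ ^ 2 ≤ 1 / 4 := by
  have hδ := hc.pos
  set g : ℕ → ℝ := fun j => 1 / (h ^ 2 + (j * δ) ^ 2) with hg
  have hg0 : ∀ n, 0 ≤ g n := fun n => by simp only [hg]; positivity
  have hgs : Summable g := by
    rw [← summable_nat_add_iff 1]
    have h1 : Summable fun n : ℕ => 1 / δ ^ 2 * (1 / ((n + 1 : ℕ) : ℝ) ^ 2) :=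
      ((summable_nat_add_iff 1).2 (Real.summable_one_div_nat_pow.2 one_lt_two)).mul_left _
    refine h1.of_nonneg_of_le (fun n => hg0 _) fun n => ?_
    rw [one_div_mul_one_div]
    refine one_div_le_one_div_of_le (by positivity) ?_
    nlinarith [sq_nonneg h]
  have hS0 : 0 ≤ S := (hβ 1).trans (hS 1)
  calc ∑ k ∈ s, β k / ‖z - τ k‖ ^ 2
      ≤ ∑ k ∈ s, S * g ((cl k - c) + (c - cl k)) := Finset.sum_le_sum fun k _ => by
        rw [hg]
        simp only
        rw [mul_one_div]
        refine div_le_div₀ hS0 (hS k) (by positivity) ?_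
        rw [mul_comm (Nat.cast _)]
        exact hz k
    _ = S * ∑ k ∈ s, g ((cl k - c) + (c - cl k)) := by rw [Finset.mul_sum]
    _ ≤ S * (p * (2 * ∑' n, g n - g 0)) :=
        mul_le_mul_of_nonneg_left (hc.sum_dist_le hcl s c hg0 hgs) hS0
    _ ≤ 1 / 4 := by
        have h1 : 0 ≤ S * (p * g 0) := mul_nonneg hS0 (mul_nonneg (by positivity) (hg0 0))
        linarith

/-- Each of the parts k ≥ M and k < M contributes at most 1/8: the first because β_k is small, the
second because its clusters are far to the left of c. -/
theorem sum_div_sq_le_of_wall {β : ℕ+ → ℝ} {S : ℝ} {z : ℂ} {c M N : ℕ} (hp : 1 ≤ p)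
    (hβ : ∀ k, 0 ≤ β k) (hS : ∀ k, β k ≤ S)
    (hM : ∀ k : ℕ+, M ≤ (k : ℕ) → β k ≤ δ ^ 2 * (1 / (8 * p * (1 + Real.pi ^ 2 / 3))))
    (hN : S ≤ δ ^ 2 / 4 * (2 * (p : ℝ) * ∑' j : ℕ, 1 / ((N : ℝ) + 1 + j) ^ 2)⁻¹)
    (hcK : M + N ≤ c) (hz₀ : ∀ k : ℕ+, δ ≤ ‖z - τ k‖)
    (hz : ∀ k : ℕ+, δ * ((cl k - c) + (c - cl k) : ℕ) ≤ ‖z - τ k‖)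
    (s : Finset ℕ+) : ∑ k ∈ s, β k / ‖z - τ k‖ ^ 2 ≤ 1 / 4 := by
  have hδ := hc.pos
  have hS0 : 0 ≤ S := (hβ 1).trans (hS 1)
  have hp0 : (0 : ℝ) < p := by exact_mod_cast hp
  have hfar : ∑ k ∈ s.filter (fun k : ℕ+ => M ≤ (k : ℕ)), β k / ‖z - τ k‖ ^ 2 ≤ 1 / 8 := by
    set b := δ ^ 2 * (1 / (8 * p * (1 + Real.pi ^ 2 / 3))) with hb
    have hb0 : 0 ≤ b := by positivity
    -- In cluster c itself the index distance 0 is replaced by the bound δ from `hz₀`. The two-sided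
    -- sum is (1 + 2 · π²/6)/δ², which explains 1 + π²/3.
    set g : ℕ → ℝ := fun n => 1 / (δ * max 1 (n : ℝ)) ^ 2 with hg
    have hg0 : ∀ n, 0 ≤ g n := fun n => by simp only [hg]; positivity
    have hg1 : HasSum (fun n => g (n + 1)) (1 / δ ^ 2 * (Real.pi ^ 2 / 6)) := by
      have h1 := (hasSum_nat_add_iff' 1).2 hasSum_zeta_two
      simp only [Finset.range_one, Finset.sum_singleton, Nat.cast_zero, ne_eq, OfNat.ofNat_ne_zero,
        not_false_eq_true, zero_pow, div_zero, sub_zero] at h1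
      refine (h1.mul_left (1 / δ ^ 2)).congr_fun fun n => ?_
      simp only [hg]
      rw [max_eq_right (by push_cast; linarith [Nat.cast_nonneg (α := ℝ) n]),
        one_div_mul_one_div, mul_pow]
    have hgs : Summable g := (summable_nat_add_iff 1).1 hg1.summable
    have htsum : ∑' n, g n = 1 / δ ^ 2 + 1 / δ ^ 2 * (Real.pi ^ 2 / 6) := by
      rw [hgs.tsum_eq_zero_add, hg1.tsum_eq]
      simp [hg]
    have hg00 : g 0 = 1 / δ ^ 2 := by simp [hg]
    calc ∑ k ∈ s.filter (fun k : ℕ+ => M ≤ (k : ℕ)), β k / ‖z - τ k‖ ^ 2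
        ≤ ∑ k ∈ s.filter (fun k : ℕ+ => M ≤ (k : ℕ)), b * g ((cl k - c) + (c - cl k)) := by
          refine Finset.sum_le_sum fun k hk => ?_
          simp only [hg]
          rw [mul_one_div]
          refine div_le_div₀ hb0 (hM k (Finset.mem_filter.1 hk).2) (by positivity) ?_
          gcongr
          rcases max_choice (1 : ℝ) ((cl k - c) + (c - cl k) : ℕ) with h | h
          · rw [h, mul_one]; exact hz₀ k
          · rw [h]; exact hz k
      _ = b * ∑ k ∈ s.filter (fun k : ℕ+ => M ≤ (k : ℕ)), g ((cl k - c) + (c - cl k)) := by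
          rw [Finset.mul_sum]
      _ ≤ b * (p * (2 * ∑' n, g n - g 0)) :=
          mul_le_mul_of_nonneg_left (hc.sum_dist_le hcl _ c hg0 hgs) hb0
      _ = 1 / 8 := by
          rw [htsum, hg00, hb]
          have : (1 + Real.pi ^ 2 / 3) ≠ 0 := by positivity
          field_simp
          ring
  have hnear : ∑ k ∈ s.filter (fun k : ℕ+ => ¬ M ≤ (k : ℕ)), β k / ‖z - τ k‖ ^ 2 ≤ 1 / 8 := by
    set g : ℕ → ℝ := fun j => 1 / ((N : ℝ) + 1 + j) ^ 2 with hg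
    have hg0 : ∀ n, 0 ≤ g n := fun n => by simp only [hg]; positivity
    have hgs : Summable g := by
      refine ((summable_nat_add_iff (N + 1)).2
        (Real.summable_one_div_nat_pow.2 one_lt_two)).congr fun n => ?_
      simp only [hg]
      push_cast
      ring_nf
    have hpos : 0 < ∑' n, g n := hgs.tsum_pos hg0 0 (by simp only [hg]; positivity)
    have hlt : ∀ k : ℕ+, cl k < k := fun k => (hc.le_e _).trans_lt (hcl k).1
    calc ∑ k ∈ s.filter (fun k : ℕ+ => ¬ M ≤ (k : ℕ)), β k / ‖z - τ k‖ ^ 2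
        -- Since cl k < k < M and c ≥ M + N, one has c - cl k ≥ N + 1 + (M - 1 - cl k), which starts
        -- the series at N + 1.
        ≤ ∑ k ∈ s.filter (fun k : ℕ+ => ¬ M ≤ (k : ℕ)), S / δ ^ 2 * g (M - 1 - cl k) := by
          refine Finset.sum_le_sum fun k hk => ?_
          have hk' := (Finset.mem_filter.1 hk).2
          have hk'' := hlt k
          simp only [hg]
          rw [div_mul_div_comm, mul_one]
          refine div_le_div₀ hS0 (hS k) (by positivity) ?_
          rw [← mul_pow]
          refine pow_le_pow_left₀ (by positivity) (le_trans ?_ (hz k)) 2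
          refine mul_le_mul_of_nonneg_left ?_ hδ.le
          exact_mod_cast (by omega : N + 1 + (M - 1 - cl k) ≤ (cl k - c) + (c - cl k))
      _ = S / δ ^ 2 * ∑ k ∈ s.filter (fun k : ℕ+ => ¬ M ≤ (k : ℕ)), g (M - 1 - cl k) := by
          rw [Finset.mul_sum]
      _ ≤ S / δ ^ 2 * (p * ∑' n, g n) := by
          refine mul_le_mul_of_nonneg_left ?_ (by positivity)
          refine sum_le_mul_tsum_of_card_fiber_le _ _ (fun n => ?_) hg0 hgs
          refine le_trans (Finset.card_le_card fun k hk => ?_)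
            (hc.card_filter_cluster_le hcl s (M - 1 - n))
          have := hlt k
          simp only [Finset.mem_filter] at hk ⊢
          obtain ⟨⟨hks, hk1⟩, hk2⟩ := hk
          exact ⟨hks, by omega⟩
      _ ≤ (δ ^ 2 / 4 * (2 * (p : ℝ) * ∑' n, g n)⁻¹) / δ ^ 2 * (p * ∑' n, g n) := by
          gcongr
      _ = 1 / 8 := by
          field_simp
          norm_num
  rw [← Finset.sum_filter_add_sum_filter_not s fun k : ℕ+ => M ≤ (k : ℕ)]
  linarith

end IsClustering

end Clusters

/-! ### The nodes of the theorem as a clustering -/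

section Nodes

/-- If p consecutive gaps were all below d/p, their telescoping sum would contradict `hgap`. Hence
the infimum is over a nonempty set and is attained. -/
theorem gapOffset_spec {t : ℕ → ℝ} {p : ℕ} {d : ℝ} (hp : 1 ≤ p)
    (hgap : ∀ k : ℕ, 1 ≤ k → d < t (k + p) - t k) {k : ℕ} (hk : 1 ≤ k) :
    gapOffset t p d k < p ∧
      d / p ≤ t (k + gapOffset t p d k + 1) - t (k + gapOffset t p d k) := by
  have hp0 : (0 : ℝ) < p := by exact_mod_cast hp
  have hex : ∃ g < p, d / p ≤ t (k + g + 1) - t (k + g) := by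
    by_contra! hlt
    have h1 : ∑ g ∈ Finset.range p, (t (k + (g + 1)) - t (k + g)) ≤
        ∑ _g ∈ Finset.range p, d / p :=
      Finset.sum_le_sum fun g hg => (hlt g (Finset.mem_range.1 hg)).le
    rw [Finset.sum_range_sub (fun g => t (k + g)), Finset.sum_const, Finset.card_range,
      nsmul_eq_mul, mul_div_cancel₀ _ hp0.ne', add_zero] at h1
    linarith [hgap k hk]
  obtain ⟨g, hgp, hg⟩ := hex
  exact ⟨(Nat.sInf_le (s := {g : ℕ | d / p ≤ t (k + g + 1) - t (k + g)}) hg).trans_lt hgp,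
    Nat.sInf_mem (s := {g : ℕ | d / p ≤ t (k + g + 1) - t (k + g)}) ⟨g, hg⟩⟩

/-- The last index of each cluster. -/
noncomputable def clusterEnd (t : ℕ → ℝ) (p : ℕ) (d : ℝ) : ℕ → ℕ
  | 0 => 0
  | c + 1 => nodeIndex t p d (c + 2)

/-- The sequence `t`, with a value at `0` that is at the distance `d / p` from `t 1`. -/
noncomputable def extendNodes (t : ℕ → ℝ) (p : ℕ) (d : ℝ) : ℕ → ℝ
  | 0 => t 1 - 2 * (d / (2 * p))
  | k + 1 => t (k + 1)

theorem extendNodes_of_pos (t : ℕ → ℝ) (p : ℕ) (d : ℝ) {k : ℕ} (hk : 0 < k) :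
    extendNodes t p d k = t k := by
  obtain ⟨m, rfl⟩ := Nat.exists_eq_succ_of_ne_zero hk.ne'
  rfl

/-- Starting at 0 instead of j_1 = 1 makes j_2 = 1 + γ(1) an instance of the general recursion. -/
theorem clusterEnd_succ (t : ℕ → ℝ) (p : ℕ) (d : ℝ) (c : ℕ) :
    clusterEnd t p d (c + 1) =
      clusterEnd t p d c + 1 + gapOffset t p d (clusterEnd t p d c + 1) := by
  cases c <;> simp [clusterEnd, nodeIndex]

theorem isClustering {t : ℕ → ℝ} {p : ℕ} {d : ℝ} (ht : ∀ k : ℕ, 1 ≤ k → t k < t (k + 1))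
    (hp : 1 ≤ p) (hd : 0 < d) (hgap : ∀ k : ℕ, 1 ≤ k → d < t (k + p) - t k) :
    IsClustering (extendNodes t p d) (clusterEnd t p d) p (d / (2 * p)) := by
  have hp0 : (0 : ℝ) < p := by exact_mod_cast hp
  have hδ : 0 < d / (2 * p) := by positivity
  have h2δ : 2 * (d / (2 * p)) = d / p := by field_simp
  refine ⟨strictMono_nat_of_lt_succ fun k => ?_, rfl, fun c => ?_, fun c => ?_, hδ, fun c => ?_⟩
  · rcases k with _ | k
    · show t 1 - 2 * (d / (2 * p)) < t 1
      linarith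
    · exact ht (k + 1) (by omega)
  · rw [clusterEnd_succ]; omega
  · have := (gapOffset_spec hp hgap (k := clusterEnd t p d c + 1) (by omega)).1
    rw [clusterEnd_succ]; omega
  · rcases c with _ | c
    · show 2 * (d / (2 * p)) ≤ t 1 - (t 1 - 2 * (d / (2 * p)))
      linarith
    · have := (gapOffset_spec hp hgap (k := clusterEnd t p d c + 1) (by omega)).2
      rw [clusterEnd_succ, extendNodes_of_pos _ _ _ (by omega),
        extendNodes_of_pos _ _ _ (by omega), h2δ]
      exact this

theorem node_eq (t : ℕ → ℝ) (p : ℕ) (d : ℝ) (c : ℕ) (hpos : 0 < clusterEnd t p d (c + 1)) :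
    node t p d (c + 2) = extendNodes t p d (clusterEnd t p d (c + 1)) := by
  rw [extendNodes_of_pos _ _ _ hpos]
  rfl

theorem rightEnd_eq (t : ℕ → ℝ) (p : ℕ) (d : ℝ) (c : ℕ) :
    rightEnd t p d (c + 1) =
      wall (extendNodes t p d) (clusterEnd t p d) (d / (2 * p)) (c + 1) := by
  rw [rightEnd, wall, ← node_eq]
  rw [clusterEnd_succ]; omega

/-- The artificial value t 1 - 2δ at index 0 puts wall 0 at t 1 - δ, so F_1 needs no separate
treatment. -/
theorem leftEnd_eq (t : ℕ → ℝ) (p : ℕ) (d : ℝ) (c : ℕ) :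
    leftEnd t p d (c + 1) =
      wall (extendNodes t p d) (clusterEnd t p d) (d / (2 * p)) c := by
  rcases c with _ | c
  · rw [leftEnd, if_pos rfl]
    show t 1 - d / (2 * p) = t 1 - 2 * (d / (2 * p)) + d / (2 * p)
    ring
  · rw [leftEnd, if_neg (by omega), wall, ← node_eq]
    rw [clusterEnd_succ]; omega

theorem exists_finset_pnat_Ioc (a b : ℕ) :
    ∃ F : Finset ℕ+, (∀ k : ℕ+, k ∈ F ↔ a < k ∧ (k : ℕ) ≤ b) ∧ F.card = b - a := by
  classical
  refine ⟨(Finset.Ioc a b).preimage (fun k : ℕ+ => (k : ℕ)) PNat.coe_injective.injOn,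
    fun k => by rw [Finset.mem_preimage, Finset.mem_Ioc], ?_⟩
  rw [Finset.card_preimage, Finset.filter_true_of_mem, Nat.card_Ioc]
  intro x hx
  exact ⟨⟨x, (Nat.zero_le a).trans_lt (Finset.mem_Ioc.1 hx).1⟩, rfl⟩

end Nodes

/-! ### Counting in clusters and distances from the contours -/

namespace IsClustering

variable {τ : ℕ → ℝ} {e : ℕ → ℕ} {p : ℕ} {δ : ℝ} (hc : IsClustering τ e p δ)

include hc

theorem sum_Icc_eq (K : ℕ) : ∑ j ∈ Finset.Icc 1 K, (e j - e (j - 1)) = e K := by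
  induction K with
  | zero => simp [hc.zero]
  | succ K ih =>
    rw [Finset.sum_Icc_succ_top (by omega), ih]
    have := hc.lt_succ K
    simp only [Nat.add_sub_cancel]
    omega

theorem e_le_mul (K : ℕ) : e K ≤ p * K := by
  induction K with
  | zero => simp [hc.zero]
  | succ K ih =>
    have := hc.succ_le K
    rw [mul_add, mul_one]
    omega

theorem le_norm_sub_of_mem_rectSides {c k : ℕ} {z : ℂ}
    (hz : z ∈ rectSides (wall τ e δ c) (wall τ e δ (c + 1)) (-δ) δ) : δ ≤ ‖z - τ k‖ := by
  have h1 := Complex.abs_re_le_norm (z - τ k)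
  have h2 := Complex.abs_im_le_norm (z - τ k)
  simp only [Complex.sub_re, Complex.sub_im, Complex.ofReal_re, Complex.ofReal_im, sub_zero]
    at h1 h2
  rcases hz.2 with h | h | h | h
  · rw [h] at h1; exact (hc.le_dist_wall c k).trans h1
  · rw [h] at h1; exact (hc.le_dist_wall (c + 1) k).trans h1
  · rw [h, abs_neg] at h2; exact (le_abs_self δ).trans h2
  · rw [h] at h2; exact (le_abs_self δ).trans h2

/-- Points above, below or to the left of the big rectangle are far from all clusters. -/
theorem exists_height_add_sq_le {cl : ℕ+ → ℕ}
    (hcl : ∀ k : ℕ+, e (cl k) < k ∧ (k : ℕ) ≤ e (cl k + 1)) {h : ℝ} (hh : 0 < h) {z : ℂ}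
    (hz : z.re ≤ τ 1 - h ∨ h ≤ |z.im|) :
    ∃ c, ∀ k : ℕ+, h ^ 2 + (δ * ((cl k - c) + (c - cl k) : ℕ)) ^ 2 ≤ ‖z - τ k‖ ^ 2 := by
  have hδ := hc.pos
  have hsq : ∀ k : ℕ+, ‖z - τ k‖ ^ 2 = (z.re - τ k) ^ 2 + z.im ^ 2 := fun k => by
    rw [Complex.sq_norm, Complex.normSq_apply]
    simp
    ring
  rcases hz with hz | hz
  -- To the left, τ_k - Re z ≥ h + (τ_k - τ_1), and τ_k - τ_1 is at least δ times the cluster index;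
  -- squaring drops a nonnegative cross term.
  · refine ⟨0, fun k => ?_⟩
    have h0 : τ 1 ≤ wall τ e δ (0 + 1) := by
      have := hc.le_wall_sub_of_le (c := 0 + 1) (k := 1) (by have := hc.lt_succ 0; omega)
      linarith
    have h1 := hc.mul_dist_le (Or.inl rfl) h0 (hcl k).1 (hcl k).2
    have h2 : τ 1 ≤ τ k := hc.strictMono.monotone k.pos
    rw [abs_sub_comm, abs_of_nonneg (by linarith)] at h1
    rw [hsq]
    have h3 : 0 ≤ δ * ((cl k - 0) + (0 - cl k) : ℕ) := by positivity
    nlinarith [sq_nonneg z.im, mul_nonneg hh.le (by linarith : 0 ≤ τ k - τ 1),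
      mul_self_le_mul_self h3 h1,
      mul_self_le_mul_self (by linarith : 0 ≤ h + (τ k - τ 1))
        (by linarith : h + (τ k - τ 1) ≤ τ k - z.re)]
  · obtain ⟨c, hc₁, hc₂⟩ : ∃ c, (c = 0 ∨ wall τ e δ c ≤ z.re) ∧ z.re ≤ wall τ e δ (c + 1) := by
      rcases le_total (wall τ e δ 0) z.re with h | h
      · obtain ⟨c, h1, h2⟩ := hc.exists_wall h
        exact ⟨c, Or.inr h1, h2⟩
      · exact ⟨0, Or.inl rfl, h.trans (hc.wall_mono (Nat.zero_le _))⟩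
    refine ⟨c, fun k => ?_⟩
    have h1 := hc.mul_dist_le hc₁ hc₂ (hcl k).1 (hcl k).2
    have h2 : (δ * ((cl k - c) + (c - cl k) : ℕ)) ^ 2 ≤ (z.re - τ k) ^ 2 := by
      rw [← sq_abs (z.re - τ k)]
      exact pow_le_pow_left₀ (by positivity) h1 2
    have h3 : h ^ 2 ≤ z.im ^ 2 := by
      rw [← sq_abs z.im]
      exact pow_le_pow_left₀ hh.le hz 2
    rw [hsq]
    linarith

end IsClustering

/-- The real supremum of an unbounded family defaults to 0, so boundedness is needed before it can
be used as an upper bound. -/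
theorem bddAbove_range_of_eventually_le {β : ℕ+ → ℝ} {M : ℕ} {b : ℝ}
    (hM : ∀ k : ℕ+, M ≤ (k : ℕ) → β k ≤ b) : BddAbove (Set.range β) := by
  have hfin : Set.Finite {k : ℕ+ | (k : ℕ) < M} :=
    (Set.finite_Iio M).preimage PNat.coe_injective.injOn
  refine ((hfin.image β).bddAbove.union (bddAbove_Iic (a := b))).mono ?_
  rintro _ ⟨k, rfl⟩
  rcases lt_or_ge (k : ℕ) M with h | h
  · exact Or.inl ⟨k, h, rfl⟩
  · exact Or.inr (hM k h)

end RootSystem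

/-! ### Proof of the main theorem -/

open RootSystem

theorem mainTheorem5 {H : Type*} [NormedAddCommGroup H] [InnerProductSpace ℂ H] [CompleteSpace H]
    -- the selfadjoint operator `T` with simple eigenvalues `t 1 < t 2 < ...` and eigenbasis `φ`
    (T : H →ₗ.[ℂ] H) (hT : IsSelfAdjoint T)
    (t : ℕ → ℝ) (ht : ∀ k : ℕ, 1 ≤ k → t k < t (k + 1))
    (φ : HilbertBasis ℕ+ ℂ H) (hφ : ∀ k : ℕ+, φ k ∈ T.domain)
    (hTφ : ∀ k : ℕ+, T ⟨φ k, hφ k⟩ = ((t k : ℝ) : ℂ) • φ k)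
    (p : ℕ) (hp : 1 ≤ p) (d : ℝ) (hd : 0 < d)
    (hgap : ∀ k : ℕ, 1 ≤ k → d < t (k + p) - t k)
    -- the closed perturbation `B` with `dom T ⊆ dom B`, and `β k = ‖B φ_k‖ ^ 2`
    (B : H →ₗ.[ℂ] H) (hB : B.IsClosed) (hdom : T.domain ≤ B.domain)
    (β : ℕ+ → ℝ) (hβ : ∀ k : ℕ+, β k = ‖B ⟨φ k, hdom (hφ k)⟩‖ ^ 2)
    (hlimsup : limsup β atTop <
      (d / (2 * p)) ^ 2 * (1 / (8 * p * (1 + Real.pi ^ 2 / 3))))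
    -- the integers `M`, `N`, with `K = M + N`
    (M N K : ℕ) (hK : K = M + N) (hK1 : 1 ≤ K)
    (hM : ∀ k : ℕ+, M ≤ (k : ℕ) →
      β k ≤ (d / (2 * p)) ^ 2 * (1 / (8 * p * (1 + Real.pi ^ 2 / 3))))
    (hN : (⨆ k, β k) ≤
      d ^ 2 / (16 * p ^ 2) * (2 * (p : ℝ) * ∑' j : ℕ, 1 / ((N : ℝ) + 1 + j) ^ 2)⁻¹)
    -- the half height `h` of `Π_0`
    (h : ℝ) (hh : 0 < h)
    (hsum : 8 * p * (⨆ k, β k) * ∑' j : ℕ, 1 / (h ^ 2 + (j * d / (2 * p)) ^ 2) ≤ 1) :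
    -- the contours avoid the spectra, so that the contour integrals below are meaningful
    ((∀ j : ℕ, 1 ≤ j → frontier (RootSystem.box t p d j) ⊆ RootSystem.resolventSet T) ∧
      frontier (RootSystem.bigBox t p d K h) ⊆ RootSystem.resolventSet (T + B) ∧
      ∀ j : ℕ, K + 1 ≤ j →
        frontier (RootSystem.box t p d j) ⊆ RootSystem.resolventSet (T + B)) ∧
    -- `dim S_K = ∑_{j ≤ K} dim P_j^0 ≤ pK`
    (RootSystem.rangeDim (RootSystem.bigBoxProj (T + B) t p d K h) =
        ∑ j ∈ Finset.Icc 1 K, RootSystem.rangeDim (RootSystem.boxProj T t p d j) ∧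
      ∑ j ∈ Finset.Icc 1 K, RootSystem.rangeDim (RootSystem.boxProj T t p d j) ≤
        ((p * K : ℕ) : Cardinal)) ∧
    -- `dim P_j = dim P_j^0 ≤ p` for `j > K`
    (∀ j : ℕ, K + 1 ≤ j →
      RootSystem.rangeDim (RootSystem.boxProj (T + B) t p d j) =
          RootSystem.rangeDim (RootSystem.boxProj T t p d j) ∧
        RootSystem.rangeDim (RootSystem.boxProj T t p d j) ≤ (p : Cardinal)) ∧
    -- the bound for the resolvent outside the boxes
    (∀ z : ℂ, z ∉ RootSystem.bigBox t p d K h ∪ ⋃ j ∈ Set.Ici (K + 1), RootSystem.box t p d j →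
      z ∈ RootSystem.resolventSet (T + B) ∧
        ‖RootSystem.resolventOp (T + B) z‖ ≤ max (4 * p / d) (2 / h)) := by
  set δ : ℝ := d / (2 * p) with hδdef
  set τ := extendNodes t p d with hτdef
  set e := clusterEnd t p d with hedef
  have hc : IsClustering τ e p δ := isClustering ht hp hd hgap
  have hδ : 0 < δ := hc.pos
  have hp0 : (0 : ℝ) < p := by exact_mod_cast hp
  have hτ : ∀ k : ℕ+, τ k = t k := fun k => extendNodes_of_pos t p d k.pos
  have hTτ : ∀ k : ℕ+, T ⟨φ k, hφ k⟩ = ((τ k : ℝ) : ℂ) • φ k := fun k => by rw [hτ, hTφ]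
  have hτ1 : τ 1 = t 1 := rfl
  have hnode1 : node t p d 1 = τ 1 := rfl
  have hleft : ∀ c, leftEnd t p d (c + 1) = wall τ e δ c := leftEnd_eq t p d
  have hright : ∀ c, rightEnd t p d (c + 1) = wall τ e δ (c + 1) := rightEnd_eq t p d
  -- This needs K ≥ 1: for K = 0 the left side would be t 1 + δ, while wall 0 is t 1 - δ.
  have hnodeK : node t p d (K + 1) + δ = wall τ e δ K := by
    obtain ⟨c, rfl⟩ : ∃ c, K = c + 1 := ⟨K - 1, by omega⟩
    exact hright c
  choose cl hcl using hc.exists_cluster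
  have hβ0 : ∀ k, 0 ≤ β k := fun k => by rw [hβ]; positivity
  have hbdd : BddAbove (Set.range β) := bddAbove_range_of_eventually_le hM
  have hS : ∀ k, β k ≤ ⨆ k, β k := le_ciSup hbdd
  have hN' : (⨆ k, β k) ≤
      δ ^ 2 / 4 * (2 * (p : ℝ) * ∑' j : ℕ, 1 / ((N : ℝ) + 1 + j) ^ 2)⁻¹ := by
    refine hN.trans_eq ?_
    congr 1
    rw [hδdef]
    field_simp
    norm_num
  have hsum' : 8 * p * (⨆ k, β k) * ∑' j : ℕ, 1 / (h ^ 2 + (j * δ) ^ 2) ≤ 1 := by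
    simpa only [hδdef, ← mul_div_assoc] using hsum
  -- points between the walls to the right of the big rectangle
  have hwall : ∀ z : ℂ, ∀ c, K ≤ c → wall τ e δ c ≤ z.re → z.re ≤ wall τ e δ (c + 1) →
      (∀ k : ℕ+, δ ≤ ‖z - τ k‖) →
      ∃ R C : H →L[ℂ] H, IsResolventAt T z R ∧ ‖R‖ ≤ 1 / δ ∧
        (∀ f, ∃ hf : R f ∈ B.domain, B ⟨R f, hf⟩ = C f) ∧ ‖C‖ ≤ 1 / 2 := by
    intro z c hKc h1 h2 hz
    refine exists_isResolventAt_and_comp hT hTτ hB hdom hδ hz fun s => ?_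
    have := hc.sum_div_sq_le_of_wall hcl (z := z) (c := c) hp hβ0 hS hM hN' (by omega) hz
      (fun k => (hc.mul_dist_le (Or.inr h1) h2 (hcl k).1 (hcl k).2).trans
        (by simpa using Complex.abs_re_le_norm (z - τ k))) s
    simpa only [hβ] using this
  -- points above, below or to the left of the big rectangle
  have hheight : ∀ z : ℂ, (z.re ≤ min (node t p d 1) 0 - h ∨ h ≤ |z.im|) →
      ∃ R C : H →L[ℂ] H, IsResolventAt T z R ∧ ‖R‖ ≤ 1 / h ∧
        (∀ f, ∃ hf : R f ∈ B.domain, B ⟨R f, hf⟩ = C f) ∧ ‖C‖ ≤ 1 / 2 := by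
    intro z hz
    have hz' : z.re ≤ τ 1 - h ∨ h ≤ |z.im| := by
      refine hz.imp_left fun h1 => h1.trans ?_
      rw [hnode1]
      linarith [min_le_left (τ 1) 0]
    obtain ⟨c, hcz⟩ := hc.exists_height_add_sq_le hcl hh hz'
    refine exists_isResolventAt_and_comp hT hTτ hB hdom hh (fun k => ?_) fun s => ?_
    · refine (sq_le_sq₀ hh.le (norm_nonneg _)).1 ?_
      exact (le_add_of_nonneg_right (sq_nonneg _)).trans (hcz k)
    · simpa only [hβ] using hc.sum_div_sq_le_of_height hcl hβ0 hS hh hsum' hcz s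
  have hpert : ∀ (z : ℂ) (r : ℝ), (∃ R C : H →L[ℂ] H, IsResolventAt T z R ∧ ‖R‖ ≤ 1 / r ∧
        (∀ f, ∃ hf : R f ∈ B.domain, B ⟨R f, hf⟩ = C f) ∧ ‖C‖ ≤ 1 / 2) →
      z ∈ resolventSet (T + B) ∧ ‖resolventOp (T + B) z‖ ≤ 2 / r := by
    rintro z r ⟨R, C, hR, hRn, hC, hCn⟩
    obtain ⟨U, -, hUn, hU⟩ := hR.perturb hC hCn (s := 1) (by simp)
    rw [one_smul] at hU
    refine ⟨hU.mem, ?_⟩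
    rw [hU.resolventOp_eq]
    refine (norm_mul_le _ _).trans ((mul_le_mul hRn hUn (norm_nonneg _)
      ((norm_nonneg _).trans hRn)).trans_eq ?_)
    ring
  have hside : ∀ c, ∀ z ∈ rectSides (wall τ e δ c) (wall τ e δ (c + 1)) (-δ) δ,
      z ∈ resolventSet T := by
    intro c z hz
    obtain ⟨R, hR, -⟩ := exists_isResolventAt_diagonal hT hTτ hδ
      fun k => hc.le_norm_sub_of_mem_rectSides (k := k) hz
    exact hR.mem
  -- The right side of Γ_0 is controlled by δ and the other three by h; the path argument needs one
  -- common bound.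
  have hbig : ∀ z ∈ rectSides (min (node t p d 1) 0 - h) (wall τ e δ K) (-h) h,
      ∃ R C : H →L[ℂ] H, IsResolventAt T z R ∧ ‖R‖ ≤ 1 / min δ h ∧
        (∀ f, ∃ hf : R f ∈ B.domain, B ⟨R f, hf⟩ = C f) ∧ ‖C‖ ≤ 1 / 2 := by
    have hδm : 1 / δ ≤ 1 / min δ h :=
      one_div_le_one_div_of_le (lt_min hδ hh) (min_le_left _ _)
    have hhm : 1 / h ≤ 1 / min δ h :=
      one_div_le_one_div_of_le (lt_min hδ hh) (min_le_right _ _)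
    have hH : ∀ z : ℂ, (z.re ≤ min (node t p d 1) 0 - h ∨ h ≤ |z.im|) →
        ∃ R C : H →L[ℂ] H, IsResolventAt T z R ∧ ‖R‖ ≤ 1 / min δ h ∧
        (∀ f, ∃ hf : R f ∈ B.domain, B ⟨R f, hf⟩ = C f) ∧ ‖C‖ ≤ 1 / 2 := fun z hz => by
      obtain ⟨R, C, h1, h2, h3⟩ := hheight z hz
      exact ⟨R, C, h1, h2.trans hhm, h3⟩
    intro z hz
    rcases hz.2 with hz' | hz' | hz' | hz'
    · exact hH z (Or.inl hz'.le)
    · obtain ⟨R, C, h1, h2, h3⟩ := hwall z K le_rfl hz'.ge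
        (hz'.le.trans (hc.wall_mono (Nat.le_succ K))) fun k => by
          refine (hc.le_dist_wall K k).trans ?_
          rw [← hz']
          simpa using Complex.abs_re_le_norm (z - τ k)
      exact ⟨R, C, h1, h2.trans hδm, h3⟩
    · exact hH z (Or.inr (by rw [hz', abs_neg]; exact le_abs_self h))
    · exact hH z (Or.inr (by rw [hz']; exact le_abs_self h))
  have hsmall : ∀ c, K ≤ c → ∀ z ∈ rectSides (wall τ e δ c) (wall τ e δ (c + 1)) (-δ) δ,
      ∃ R C : H →L[ℂ] H, IsResolventAt T z R ∧ ‖R‖ ≤ 1 / δ ∧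
        (∀ f, ∃ hf : R f ∈ B.domain, B ⟨R f, hf⟩ = C f) ∧ ‖C‖ ≤ 1 / 2 :=
    fun c hKc z hz => hwall z c hKc hz.1.1.1 hz.1.1.2
      fun k => hc.le_norm_sub_of_mem_rectSides (k := k) hz
  have hrank : ∀ c, rangeDim (boxProj T t p d (c + 1)) = ((e (c + 1) - e c : ℕ) : Cardinal) := by
    intro c
    obtain ⟨F, hF, hFc⟩ := exists_finset_pnat_Ioc (e c) (e (c + 1))
    rw [boxProj, hleft, hright, ← hFc]
    refine rangeDim_rieszIntegral_diagonal hTτ (hc.wall_mono (Nat.le_succ c)) (by linarith) hδ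
      (hside c) F (fun k hk => ?_) fun k hk => ?_
    · have h1 := hc.wall_add_le_of_lt ((hF k).1 hk).1
      have h2 := hc.le_wall_sub_of_le ((hF k).1 hk).2
      exact ⟨by linarith, by linarith⟩
    · rw [hF, not_and_or, not_lt, not_le] at hk
      rcases hk with hk | hk
      · have := hc.le_wall_sub_of_le hk
        exact Or.inl (by linarith)
      · have := hc.wall_add_le_of_lt hk
        exact Or.inr (by linarith)
  have hτ1K : min (node t p d 1) 0 - h < τ 1 := by
    rw [hnode1]
    linarith [min_le_left (τ 1) 0]
  have hbigle : min (node t p d 1) 0 - h ≤ wall τ e δ K := by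
    have h1 := hc.le_wall_sub_of_le (c := K) (k := 1) (hK1.trans (hc.le_e K))
    linarith
  have hrank0 : rangeDim (bigBoxProj T t p d K h) = (e K : Cardinal) := by
    obtain ⟨F, hF, hFc⟩ := exists_finset_pnat_Ioc 0 (e K)
    rw [Nat.sub_zero] at hFc
    rw [bigBoxProj, hnodeK, ← hFc]
    refine rangeDim_rieszIntegral_diagonal hTτ hbigle (by linarith) hh (fun z hz => ?_) F
      (fun k hk => ?_) fun k hk => ?_
    · obtain ⟨R, C, hR, -⟩ := hbig z hz
      exact hR.mem
    · have h1 := hc.le_wall_sub_of_le ((hF k).1 hk).2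
      have h2 : τ 1 ≤ τ k := hc.strictMono.monotone k.pos
      exact ⟨by linarith, by linarith⟩
    · rw [hF, not_and_or, not_lt, not_le] at hk
      have := hc.wall_add_le_of_lt (hk.resolve_left (by have := k.pos; omega))
      exact Or.inr (by linarith)
  have hsumrank : ∑ j ∈ Finset.Icc 1 K, rangeDim (boxProj T t p d j) = (e K : Cardinal) := by
    rw [← hc.sum_Icc_eq K, Nat.cast_sum]
    refine Finset.sum_congr rfl fun j hj => ?_
    obtain ⟨c, rfl⟩ : ∃ c, j = c + 1 := ⟨j - 1, by have := (Finset.mem_Icc.1 hj).1; omega⟩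
    exact hrank c
  refine ⟨⟨fun j hj => ?_, ?_, fun j hj => ?_⟩, ⟨?_, ?_⟩, fun j hj => ⟨?_, ?_⟩, fun z hz => ?_⟩
  · obtain ⟨c, rfl⟩ : ∃ c, j = c + 1 := ⟨j - 1, by omega⟩
    rw [box, hleft, hright]
    exact (frontier_rect_subset _ _ _ _).trans (hside c)
  · rw [bigBox, hnodeK]
    exact fun z hz => (hpert z _ (hbig z (frontier_rect_subset _ _ _ _ hz))).1
  · obtain ⟨c, rfl⟩ : ∃ c, j = c + 1 := ⟨j - 1, by omega⟩
    rw [box, hleft, hright]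
    exact fun z hz =>
      (hpert z _ (hsmall c (by omega) z (frontier_rect_subset _ _ _ _ hz))).1
  · rw [hsumrank, ← hrank0, bigBoxProj, bigBoxProj, hnodeK]
    exact rangeDim_rieszIntegral_add hdom hbigle (by linarith) hbig
  · rw [hsumrank]
    exact_mod_cast hc.e_le_mul K
  · obtain ⟨c, rfl⟩ : ∃ c, j = c + 1 := ⟨j - 1, by omega⟩
    rw [boxProj, boxProj, hleft, hright]
    exact rangeDim_rieszIntegral_add hdom (hc.wall_mono (Nat.le_succ c)) (by linarith)
      (hsmall c (by omega))
  · obtain ⟨c, rfl⟩ : ∃ c, j = c + 1 := ⟨j - 1, by omega⟩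
    rw [hrank]
    have := hc.succ_le c
    exact_mod_cast (by omega : e (c + 1) - e c ≤ p)
  · rw [Set.mem_union, not_or] at hz
    obtain ⟨hz₀, hz₁⟩ := hz
    -- In this case the bound is 2/h. Otherwise z lies to the right of wall K and between two walls,
    -- and avoiding the box there forces |Im z| ≥ δ; this gives 2/δ = 4p/d.
    by_cases hB' : z.re ≤ min (node t p d 1) 0 - h ∨ h ≤ |z.im|
    · obtain ⟨h1, h2⟩ := hpert z h (hheight z hB')
      exact ⟨h1, h2.trans (le_max_right _ _)⟩
    · rw [not_or, not_le, not_le] at hB'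
      have hre : wall τ e δ K < z.re := by
        by_contra! hle
        refine hz₀ ⟨⟨hB'.1.le, ?_⟩, abs_le.1 hB'.2.le⟩
        rwa [← hnodeK] at hle
      obtain ⟨c, hc₁, hc₂⟩ := hc.exists_wall ((hc.wall_mono (Nat.zero_le K)).trans hre.le)
      have hKc : K ≤ c := by
        by_contra! hlt
        have := hc.wall_mono (show c + 1 ≤ K from hlt)
        linarith
      have him : δ ≤ |z.im| := by
        by_contra! hlt
        refine hz₁ (Set.mem_biUnion (show c + 1 ∈ Set.Ici (K + 1) from by simpa using hKc) ?_)
        rw [box, hleft, hright]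
        exact ⟨⟨hc₁, hc₂⟩, abs_le.1 hlt.le⟩
      obtain ⟨h1, h2⟩ := hpert z δ (hwall z c hKc hc₁ hc₂ fun k =>
        him.trans (by simpa using Complex.abs_im_le_norm (z - τ k)))
      refine ⟨h1, (h2.trans_eq ?_).trans (le_max_left _ _)⟩
      rw [hδdef]
      field_simp
      norm_num
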